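/- Let $q=e^{2\pi i/3}$, and let $A(SL_q(2))$ be the complex Hopf algebra generated by $1,a,b,c,d$ subject to $$ab=q\,ba,\quad ac=q\,ca,\quad bd=q\,db,\quad bc=cb,\quad cd=q\,dc,\quad ad-da=(q-q^{-1})\,bc,\quad ad-q\,bc=da-q^{-1}bc=1.$$ With $T=\begin{pmatrix}a&b\\c&d\end{pmatrix}$, its comultiplication and counit are $\Delta T_{ij}=\sum_k T_{ik}\otimes T_{kj}$ and $\varepsilon(T_{ij})=\delta_{ij}$, and its antipode is given by $S(a)=d$, $S(b)=-q^{-1}b$, $S(c)=-qc$, $S(d)=a$. Let $A(F)=A(SL_q(2))/\langle T_{ij}^3-\delta_{ij}\rangle$ be the quotient Hopf algebra by the two-sided ideal generated by the elements $T_{ij}^3-\delta_{ij}$ ($i,j\in\{1,2\}$), with canonical surjection $\pi_F$, and regard $A(SL_q(2))$ as a right $A(F)$-comodule algebra with coaction $\Delta_R=(\mathrm{id}\otimes\pi_F)\circ\Delta$. Let $A(SL(2,\mathbb C))=\mathbb C[x_{11},x_{12},x_{21},x_{22}]/(x_{11}x_{22}-x_{12}x_{21}-1)$, and let $Fr:A(SL(2,\mathbb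 C))\to A(SL_q(2))$ be the algebra homomorphism with $Fr(x_{ij})=T_{ij}^3$. Then $A(SL_q(2))$ is a faithfully flat $A(F)$-Galois extension of $B:=Fr(A(SL(2,\mathbb C)))$. That is, writing $P=A(SL_q(2))$ and $H=A(F)$: 1. $B$ is the subalgebra $P^{co H}=\{p\in P : \Delta_R(p)=p\otimes 1\}$ of right coinvariants; 2. the canonical map $P\otimes_B P\to P\otimes H$, $p\otimes_B p'\mapsto (p\otimes 1)\,\Delta_R(p')$, is bijective; 3. $P$ is faithfully flat both as a left and as a right $B$-module. -/

import Mathlib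

open scoped TensorProduct IsMulCommutative

noncomputable section

/-! ## Comodule algebras and Hopf-Galois extensions -/

/-- The structure of a right `H`-comodule algebra on a `k`-algebra `P`: a coassociative and
counital coaction `P → P ⊗ H` which is a homomorphism of algebras. -/
structure RightComoduleAlgebra (k H P : Type*) [CommRing k] [Ring H] [HopfAlgebra k H]
    [Ring P] [Algebra k P] where
  /-- The right coaction. -/
  coact : P →ₐ[k] P ⊗[k] H
  coassoc : (Algebra.TensorProduct.assoc k k k P H H).toAlgHom.comp
      ((Algebra.TensorProduct.map coact (AlgHom.id k H)).comp coact) =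
    (Algebra.TensorProduct.map (AlgHom.id k P) (Bialgebra.comulAlgHom k H)).comp coact
  counit : (Algebra.TensorProduct.rid k k P).toAlgHom.comp
      ((Algebra.TensorProduct.map (AlgHom.id k P) (Bialgebra.counitAlgHom k H)).comp coact) =
    AlgHom.id k P

section BalancedTensor

variable {k P : Type*} [CommRing k] [Ring P] [Algebra k P]

/-- The subspace of `P ⊗ P` spanned by the elements `p b ⊗ p' - p ⊗ b p'` with `b` in `B`. -/
def balancingRelations (B : Subalgebra k P) : Submodule k (P ⊗[k] P) :=
  Submodule.span k {x | ∃ (p : P) (b : B) (p' : P),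
    x = (p * (b : P)) ⊗ₜ[k] p' - p ⊗ₜ[k] ((b : P) * p')}

/-- The tensor product `P ⊗_B P` of the right `B`-module `P` with the left `B`-module `P`, for a
subalgebra `B` of `P`, which need not be commutative. -/
abbrev BalancedTensor (B : Subalgebra k P) : Type _ := (P ⊗[k] P) ⧸ balancingRelations B

end BalancedTensor

namespace RightComoduleAlgebra

variable {k H P : Type*} [CommRing k] [Ring H] [HopfAlgebra k H] [Ring P] [Algebra k P]

/-- The subalgebra `P^{co H} = {p | ρ(p) = p ⊗ 1}` of right coinvariants. -/
def coinvariants (ρ : RightComoduleAlgebra k H P) : Subalgebra k P :=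
  AlgHom.equalizer ρ.coact Algebra.TensorProduct.includeLeft

theorem mem_coinvariants (ρ : RightComoduleAlgebra k H P) (p : P) :
    p ∈ ρ.coinvariants ↔ ρ.coact p = p ⊗ₜ[k] 1 := Iff.rfl

/-- The linear map `P ⊗ P → P ⊗ H`, `p ⊗ p' ↦ (p ⊗ 1) ρ(p')`. -/
def preCan (ρ : RightComoduleAlgebra k H P) : P ⊗[k] P →ₗ[k] P ⊗[k] H :=
  LinearMap.mul' k (P ⊗[k] H) ∘ₗ TensorProduct.map
    (Algebra.TensorProduct.includeLeft : P →ₐ[k] P ⊗[k] H).toLinearMap ρ.coact.toLinearMap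

@[simp]
theorem preCan_tmul (ρ : RightComoduleAlgebra k H P) (p p' : P) :
    ρ.preCan (p ⊗ₜ p') = (p ⊗ₜ[k] 1) * ρ.coact p' := by
  simp [preCan]

theorem balancingRelations_le_ker (ρ : RightComoduleAlgebra k H P) :
    balancingRelations ρ.coinvariants ≤ LinearMap.ker ρ.preCan := by
  refine Submodule.span_le.2 ?_
  rintro _ ⟨p, b, p', rfl⟩
  have hb := (ρ.mem_coinvariants b).1 b.2
  simp [hb, ← mul_assoc]

/-- The canonical map `can : P ⊗_B P → P ⊗ H`, `p ⊗ p' ↦ p p'₍₀₎ ⊗ p'₍₁₎`, where `B` is the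
subalgebra of right coinvariants. -/
def can (ρ : RightComoduleAlgebra k H P) :
    BalancedTensor ρ.coinvariants →ₗ[k] P ⊗[k] H :=
  (balancingRelations ρ.coinvariants).liftQ ρ.preCan ρ.balancingRelations_le_ker

/-- `P` is an `H`-Galois extension of the subalgebra `B`: the subalgebra `B` consists of all
right coinvariants, and the canonical map is bijective. -/
structure IsGaloisExtension (ρ : RightComoduleAlgebra k H P) (B : Subalgebra k P) : Prop where
  coinvariants_eq : ρ.coinvariants = B
  can_bijective : Function.Bijective ρ.can

/-- If `B` is commutative, then so is its opposite. -/
instance isMulCommutative_op (B : Subalgebra k P) [IsMulCommutative B] :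
    IsMulCommutative B.op :=
  .of_setLike_mul_comm fun _ hx _ hy =>
    MulOpposite.unop_injective (setLike_mul_comm (s := B) hy hx)

/-- `P` is a faithfully flat `H`-Galois extension of the commutative subalgebra `B`: it is an
`H`-Galois extension of `B`, and it is faithfully flat as a left and as a right `B`-module.
Here `B` acts on `P` from the left by multiplication, and the right `B`-module `P` is `P` as
a module over `B.op`, where `op b` acts on `P` as `p ↦ p * b`. -/
structure IsFaithfullyFlatGaloisExtension (ρ : RightComoduleAlgebra k H P) (B : Subalgebra k P)
    [IsMulCommutative B] : Prop extends ρ.IsGaloisExtension B where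
  left_faithfullyFlat : Module.FaithfullyFlat B P
  right_faithfullyFlat : Module.FaithfullyFlat B.op P

theorem op_smul_eq (B : Subalgebra k P) (b : B.op) (p : P) : b • p = p * (b : Pᵐᵒᵖ).unop := rfl

/-- For a homomorphism `π : P → H` of Hopf algebras, `(id ⊗ π) ∘ Δ` makes `P` into a right
`H`-comodule algebra. -/
def ofBialgHom {k H P : Type*} [CommRing k] [Ring H] [HopfAlgebra k H] [Ring P]
    [HopfAlgebra k P] (π : P →ₐc[k] H) : RightComoduleAlgebra k H P where
  coact := (Algebra.TensorProduct.map (AlgHom.id k P) (π : P →ₐ[k] H)).comp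
    (Bialgebra.comulAlgHom k P)
  coassoc := by
    have h : Coalgebra.comul (R := k) ∘ₗ (π : P →ₐ[k] H).toLinearMap =
        TensorProduct.map (π : P →ₐ[k] H).toLinearMap (π : P →ₐ[k] H).toLinearMap ∘ₗ
          Coalgebra.comul (R := k) (A := P) := (CoalgHomClass.map_comp_comul π).symm
    refine AlgHom.toLinearMap_injective ?_
    change (TensorProduct.assoc k P H H).toLinearMap ∘ₗ
      (TensorProduct.map (TensorProduct.map LinearMap.id (π : P →ₐ[k] H).toLinearMap ∘ₗ
          Coalgebra.comul) LinearMap.id ∘ₗ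
        (TensorProduct.map LinearMap.id (π : P →ₐ[k] H).toLinearMap ∘ₗ Coalgebra.comul)) =
      TensorProduct.map LinearMap.id Coalgebra.comul ∘ₗ
        (TensorProduct.map LinearMap.id (π : P →ₐ[k] H).toLinearMap ∘ₗ Coalgebra.comul)
    simp only [coassoc_simps, h]
  counit := by
    have h : Coalgebra.counit (R := k) ∘ₗ (π : P →ₐ[k] H).toLinearMap =
        Coalgebra.counit (R := k) (A := P) := CoalgHomClass.counit_comp π
    refine AlgHom.toLinearMap_injective ?_
    change (TensorProduct.rid k P).toLinearMap ∘ₗ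
      (TensorProduct.map LinearMap.id Coalgebra.counit ∘ₗ
        (TensorProduct.map LinearMap.id (π : P →ₐ[k] H).toLinearMap ∘ₗ Coalgebra.comul)) =
      LinearMap.id
    simp only [coassoc_simps, h]
    rw [← LinearMap.lTensor_def]
    ext x
    simp

end RightComoduleAlgebra


/-! ## The quantum group `SL_q(2)` -/

/-- The generators of the free algebra on the four matrix entries. -/
abbrev SLqGen (i j : Fin 2) : FreeAlgebra ℂ (Fin 2 × Fin 2) := FreeAlgebra.ι ℂ (i, j)

/-- The defining relations of `A(SL_q(2))`, with `a = T₀₀`, `b = T₀₁`, `c = T₁₀`, `d = T₁₁`. -/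
inductive SLqRel (q : ℂˣ) : FreeAlgebra ℂ (Fin 2 × Fin 2) → FreeAlgebra ℂ (Fin 2 × Fin 2) → Prop
  | ab : SLqRel q (SLqGen 0 0 * SLqGen 0 1) ((q : ℂ) • (SLqGen 0 1 * SLqGen 0 0))
  | ac : SLqRel q (SLqGen 0 0 * SLqGen 1 0) ((q : ℂ) • (SLqGen 1 0 * SLqGen 0 0))
  | bd : SLqRel q (SLqGen 0 1 * SLqGen 1 1) ((q : ℂ) • (SLqGen 1 1 * SLqGen 0 1))
  | bc : SLqRel q (SLqGen 0 1 * SLqGen 1 0) (SLqGen 1 0 * SLqGen 0 1)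
  | cd : SLqRel q (SLqGen 1 0 * SLqGen 1 1) ((q : ℂ) • (SLqGen 1 1 * SLqGen 1 0))
  | ad_sub_da : SLqRel q (SLqGen 0 0 * SLqGen 1 1 - SLqGen 1 1 * SLqGen 0 0)
      (((q : ℂ) - (q : ℂ)⁻¹) • (SLqGen 0 1 * SLqGen 1 0))
  | ad : SLqRel q (SLqGen 0 0 * SLqGen 1 1 - (q : ℂ) • (SLqGen 0 1 * SLqGen 1 0)) 1
  | da : SLqRel q (SLqGen 1 1 * SLqGen 0 0 - (q : ℂ)⁻¹ • (SLqGen 0 1 * SLqGen 1 0)) 1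

/-- The algebra `A(SL_q(2))`: the unital complex algebra generated by `a, b, c, d` subject to the
above relations. -/
def SLq (q : ℂˣ) : Type := RingQuot (SLqRel q)

namespace SLq

instance (q : ℂˣ) : Ring (SLq q) := inferInstanceAs (Ring (RingQuot (SLqRel q)))
instance (q : ℂˣ) : Algebra ℂ (SLq q) := inferInstanceAs (Algebra ℂ (RingQuot (SLqRel q)))

variable {q : ℂˣ}

/-- The quotient map from the free algebra. -/
def mk (q : ℂˣ) : FreeAlgebra ℂ (Fin 2 × Fin 2) →ₐ[ℂ] SLq q := RingQuot.mkAlgHom ℂ (SLqRel q)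

/-- The matrix `T = (a b; c d)` of generators of `A(SL_q(2))`. -/
def T (q : ℂˣ) (i j : Fin 2) : SLq q := mk q (SLqGen i j)

/-- The relations of `A(SL_q(2))` for a quadruple of elements `a, b, c, d` of an algebra. -/
structure Rels {A : Type*} [Ring A] [Algebra ℂ A] (q : ℂˣ) (a b c d : A) : Prop where
  ab : a * b = (q : ℂ) • (b * a)
  ac : a * c = (q : ℂ) • (c * a)
  bd : b * d = (q : ℂ) • (d * b)
  bc : b * c = c * b
  cd : c * d = (q : ℂ) • (d * c)
  ad : a * d = 1 + (q : ℂ) • (c * b)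
  da : d * a = 1 + (q : ℂ)⁻¹ • (c * b)

theorem rels (q : ℂˣ) : Rels q (T q 0 0) (T q 0 1) (T q 1 0) (T q 1 1) := by
  have h : ∀ {x y}, SLqRel q x y → mk q x = mk q y := fun h => RingQuot.mkAlgHom_rel ℂ h
  have bc : T q 0 1 * T q 1 0 = T q 1 0 * T q 0 1 := by simpa [T] using h .bc
  refine ⟨by simpa [T] using h .ab, by simpa [T] using h .ac, by simpa [T] using h .bd, bc,
    by simpa [T] using h .cd, ?_, ?_⟩
  · rw [← bc, ← sub_eq_iff_eq_add]; simpa [T] using h .ad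
  · rw [← bc, ← sub_eq_iff_eq_add]; simpa [T] using h .da

section lift

variable {A : Type*} [Ring A] [Algebra ℂ A]

/-- The universal property of `A(SL_q(2))`. -/
def lift (t : Fin 2 → Fin 2 → A) (h : Rels q (t 0 0) (t 0 1) (t 1 0) (t 1 1)) :
    SLq q →ₐ[ℂ] A :=
  RingQuot.liftAlgHom ℂ ⟨FreeAlgebra.lift ℂ fun ij => t ij.1 ij.2, by
    rintro _ _ (_ | _ | _ | _ | _ | _ | _ | _)
    · simpa using h.ab
    · simpa using h.ac
    · simpa using h.bd
    · simpa using h.bc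
    · simpa using h.cd
    · simp [h.ad, h.da, h.bc, sub_smul]
    · simp [h.ad, h.bc]
    · simp [h.da, h.bc]⟩

@[simp]
theorem lift_T (t : Fin 2 → Fin 2 → A) (h : Rels q (t 0 0) (t 0 1) (t 1 0) (t 1 1))
    (i j : Fin 2) : lift t h (T q i j) = t i j := by
  unfold lift T mk
  exact (RingQuot.liftAlgHom_mkAlgHom_apply _ _ _ _).trans (by simp)

theorem algHom_ext {f g : SLq q →ₐ[ℂ] A} (h : ∀ i j, f (T q i j) = g (T q i j)) : f = g :=
  RingQuot.ringQuot_ext' (S := ℂ) (s := SLqRel q) f g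
    (FreeAlgebra.hom_ext (funext fun ij => h ij.1 ij.2))

end lift

theorem induction {p : SLq q → Prop} (hr : ∀ r : ℂ, p (algebraMap ℂ (SLq q) r))
    (hT : ∀ i j, p (T q i j)) (hadd : ∀ x y, p x → p y → p (x + y))
    (hmul : ∀ x y, p x → p y → p (x * y)) (x : SLq q) : p x := by
  obtain ⟨y, rfl⟩ : ∃ y, mk q y = x := RingQuot.mkAlgHom_surjective ℂ (SLqRel q) x
  induction y using FreeAlgebra.induction with
  | grade0 r => simpa using hr r
  | grade1 ij => exact hT ij.1 ij.2
  | mul x y hx hy => simpa using hmul _ _ hx hy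
  | add x y hx hy => simpa using hadd _ _ hx hy

/-! ### The Hopf algebra structure -/

/-- The matrix `T ⊗ T`, whose entries are `∑ₖ Tᵢₖ ⊗ Tₖⱼ`. -/
def comulT (q : ℂˣ) (i j : Fin 2) : SLq q ⊗[ℂ] SLq q :=
  T q i 0 ⊗ₜ[ℂ] T q 0 j + T q i 1 ⊗ₜ[ℂ] T q 1 j

theorem rels_comulT (q : ℂˣ) :
    Rels q (comulT q 0 0) (comulT q 0 1) (comulT q 1 0) (comulT q 1 1) := by
  obtain ⟨ab, ac, bd, bc, cd, ad, da⟩ := rels q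
  have hq : (q : ℂ) ≠ 0 := q.ne_zero
  constructor <;>
    simp only [comulT, mul_add, add_mul, Algebra.TensorProduct.tmul_mul_tmul, ab, ac, bd, bc, cd,
      ad, da, TensorProduct.tmul_add, TensorProduct.add_tmul, TensorProduct.tmul_smul,
      ← TensorProduct.smul_tmul', smul_add, smul_smul, Algebra.TensorProduct.one_def] <;>
    match_scalars <;> field_simp

/-- The comultiplication `Δ(Tᵢⱼ) = ∑ₖ Tᵢₖ ⊗ Tₖⱼ`. -/
def comul (q : ℂˣ) : SLq q →ₐ[ℂ] SLq q ⊗[ℂ] SLq q := lift (comulT q) (rels_comulT q)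

/-- The counit `ε(Tᵢⱼ) = δᵢⱼ`. -/
def counit (q : ℂˣ) : SLq q →ₐ[ℂ] ℂ :=
  lift (fun i j => if i = j then 1 else 0) (by constructor <;> simp)

theorem comul_T (i j : Fin 2) :
    comul q (T q i j) = T q i 0 ⊗ₜ[ℂ] T q 0 j + T q i 1 ⊗ₜ[ℂ] T q 1 j := lift_T _ _ i j

theorem counit_T (i j : Fin 2) : counit q (T q i j) = if i = j then 1 else 0 := lift_T _ _ i j

instance : Bialgebra ℂ (SLq q) :=
  Bialgebra.ofAlgHom (comul q) (counit q)
    (algHom_ext fun i j => by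
      simp [comul_T, TensorProduct.add_tmul, TensorProduct.tmul_add]; abel)
    (algHom_ext fun i j => by
      fin_cases i <;> simp [comul_T, counit_T])
    (algHom_ext fun i j => by
      fin_cases j <;> simp [comul_T, counit_T])

theorem coalgebra_comul_T (i j : Fin 2) : Coalgebra.comul (R := ℂ) (T q i j) =
    T q i 0 ⊗ₜ[ℂ] T q 0 j + T q i 1 ⊗ₜ[ℂ] T q 1 j := comul_T i j

theorem coalgebra_counit_T (i j : Fin 2) :
    Coalgebra.counit (R := ℂ) (T q i j) = if i = j then 1 else 0 := counit_T i j

/-- The matrix `(d, -q⁻¹ b; -q c, a)`. -/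
def antipodeT (q : ℂˣ) : Fin 2 → Fin 2 → SLq q :=
  ![![T q 1 1, -((q : ℂ)⁻¹ • T q 0 1)], ![-((q : ℂ) • T q 1 0), T q 0 0]]

/-- The antipode, as a homomorphism to the opposite algebra. -/
def antipodeAlgHom (q : ℂˣ) : SLq q →ₐ[ℂ] (SLq q)ᵐᵒᵖ :=
  lift (fun i j => MulOpposite.op (antipodeT q i j)) (by
    obtain ⟨ab, ac, bd, bc, cd, ad, da⟩ := rels q
    have hq : (q : ℂ) ≠ 0 := q.ne_zero
    constructor <;> apply MulOpposite.unop_injective <;>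
      simp [antipodeT, ab, ac, bd, bc, cd, ad, da, smul_smul, hq])

/-- The antipode of `A(SL_q(2))`: the linear anti-multiplicative map with
`S(a) = d`, `S(b) = -q⁻¹ b`, `S(c) = -q c`, `S(d) = a`. -/
def antipode (q : ℂˣ) : SLq q →ₗ[ℂ] SLq q :=
  (MulOpposite.opLinearEquiv ℂ).symm.toLinearMap ∘ₗ (antipodeAlgHom q).toLinearMap

theorem antipode_T (i j : Fin 2) : antipode q (T q i j) = antipodeT q i j := by
  simp [antipode, antipodeAlgHom]

theorem antipode_mul (x y : SLq q) : antipode q (x * y) = antipode q y * antipode q x := by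
  simp [antipode]

theorem antipode_algebraMap (r : ℂ) :
    antipode q (algebraMap ℂ (SLq q) r) = algebraMap ℂ (SLq q) r := by
  simp [antipode]

theorem antipode_one : antipode q 1 = 1 := by
  simpa using antipode_algebraMap (q := q) 1

theorem mul_antipode_left (X Y : SLq q ⊗[ℂ] SLq q) (r : ℂ)
    (hX : LinearMap.mul' ℂ (SLq q) ((antipode q).rTensor _ X) = algebraMap ℂ _ r) :
    LinearMap.mul' ℂ (SLq q) ((antipode q).rTensor _ (X * Y)) =
      r • LinearMap.mul' ℂ (SLq q) ((antipode q).rTensor _ Y) := by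
  induction Y with
  | zero => simp
  | add Y Z hY hZ => simp [mul_add, hY, hZ]
  | tmul y z =>
    have key : LinearMap.mul' ℂ (SLq q) ((antipode q).rTensor _ (X * y ⊗ₜ z)) =
        antipode q y * LinearMap.mul' ℂ (SLq q) ((antipode q).rTensor _ X) * z := by
      clear hX
      induction X with
      | zero => simp
      | add X Z hX hZ => simp [mul_add, add_mul, hX, hZ]
      | tmul x w => simp [antipode_mul, mul_assoc]
    rw [key, hX, ← Algebra.commutes, mul_assoc, ← Algebra.smul_def]
    simp

theorem mul_antipode_right (X Y : SLq q ⊗[ℂ] SLq q) (r : ℂ)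
    (hY : LinearMap.mul' ℂ (SLq q) ((antipode q).lTensor _ Y) = algebraMap ℂ _ r) :
    LinearMap.mul' ℂ (SLq q) ((antipode q).lTensor _ (X * Y)) =
      r • LinearMap.mul' ℂ (SLq q) ((antipode q).lTensor _ X) := by
  induction X with
  | zero => simp
  | add X Z hX hZ => simp [add_mul, hX, hZ]
  | tmul x w =>
    have key : LinearMap.mul' ℂ (SLq q) ((antipode q).lTensor _ (x ⊗ₜ w * Y)) =
        x * LinearMap.mul' ℂ (SLq q) ((antipode q).lTensor _ Y) * antipode q w := by
      clear hY
      induction Y with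
      | zero => simp
      | add X Z hX hZ => simp [mul_add, add_mul, hX, hZ]
      | tmul y z => simp [antipode_mul, mul_assoc]
    rw [key, hY, ← Algebra.commutes, mul_assoc, ← Algebra.smul_def]
    simp

instance : HopfAlgebra ℂ (SLq q) where
  antipode := antipode q
  mul_antipode_rTensor_comul := by
    ext x
    induction x using SLq.induction with
    | hr r => simp [antipode_algebraMap, Algebra.TensorProduct.algebraMap_apply]
    | hT i j =>
      obtain ⟨ab, ac, bd, bc, cd, ad, da⟩ := rels q
      have hq : (q : ℂ) ≠ 0 := q.ne_zero
      fin_cases i <;> fin_cases j <;>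
        simp [coalgebra_comul_T, coalgebra_counit_T, antipode_T, antipodeT,
          ac, bd, bc, ad, da, smul_smul, hq]
    | hadd x y hx hy => simp only [map_add, hx, hy]
    | hmul x y hx hy =>
      simp only [LinearMap.comp_apply, Algebra.linearMap_apply] at hx hy ⊢
      rw [Bialgebra.comul_mul, mul_antipode_left _ _ _ hx, hy]
      simp [Algebra.smul_def]
  mul_antipode_lTensor_comul := by
    ext x
    induction x using SLq.induction with
    | hr r => simp [Algebra.TensorProduct.algebraMap_apply, antipode_one]
    | hT i j =>
      obtain ⟨ab, ac, bd, bc, cd, ad, da⟩ := rels q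
      have hq : (q : ℂ) ≠ 0 := q.ne_zero
      fin_cases i <;> fin_cases j <;>
        simp [coalgebra_comul_T, coalgebra_counit_T, antipode_T, antipodeT,
          ab, bc, cd, ad, da, smul_smul, hq]
    | hadd x y hx hy => simp only [map_add, hx, hy]
    | hmul x y hx hy =>
      simp only [LinearMap.comp_apply, Algebra.linearMap_apply] at hx hy ⊢
      rw [Bialgebra.comul_mul, mul_antipode_right _ _ _ hy, hx]
      rw [Bialgebra.counit_mul, map_mul, ← Algebra.commutes, Algebra.smul_def, Algebra.commutes,
        Algebra.commutes]


theorem antipode_eq : HopfAlgebra.antipode ℂ (A := SLq q) = antipode q := rfl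

/-! ### The cubic root of unity -/

/-- The cubic root of unity `q = exp(2πi/3)`. -/
def cubicRoot : ℂˣ :=
  Units.mk0 (Complex.exp (2 * Real.pi * Complex.I / 3)) (Complex.exp_ne_zero _)

theorem isPrimitiveRoot_cubicRoot : IsPrimitiveRoot (cubicRoot : ℂ) 3 :=
  Complex.isPrimitiveRoot_exp 3 (by norm_num)

theorem cubicRoot_pow : (cubicRoot : ℂ) ^ 3 = 1 := isPrimitiveRoot_cubicRoot.pow_eq_one

theorem cubicRoot_sum : 1 + (cubicRoot : ℂ) + (cubicRoot : ℂ) ^ 2 = 0 := by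
  simpa [Finset.sum_range_succ] using isPrimitiveRoot_cubicRoot.geom_sum_eq_zero (by norm_num)

section cubes

variable {A : Type*} [Ring A] [Algebra ℂ A]

theorem cube_mul_of_qcomm {x y : A} (h : x * y = (cubicRoot : ℂ) • (y * x)) :
    x ^ 3 * y = y * x ^ 3 := by
  have e : x * x * y = ((cubicRoot : ℂ) * cubicRoot) • (y * (x * x)) := by
    rw [mul_assoc, h, mul_smul_comm, ← mul_assoc, h, smul_mul_assoc, smul_smul, mul_assoc]
  calc x ^ 3 * y = x * (x * x * y) := by noncomm_ring
    _ = (cubicRoot : ℂ) ^ 3 • (y * x * (x * x)) := by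
      rw [e, mul_smul_comm, ← mul_assoc, h, smul_mul_assoc, smul_smul]
      congr 1; ring
    _ = y * x ^ 3 := by rw [cubicRoot_pow, one_smul]; noncomm_ring

theorem add_cube_of_qcomm {u v : A} (h : u * v = ((cubicRoot : ℂ) ^ 2) • (v * u)) :
    (u + v) ^ 3 = u ^ 3 + v ^ 3 := by
  set r : ℂ := (cubicRoot : ℂ) ^ 2 with hr
  have hs : r * r + r + 1 = 0 := by
    have h1 := cubicRoot_sum
    have h2 := cubicRoot_pow
    rw [hr]; linear_combination h1 + (cubicRoot : ℂ) * h2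
  have e1 : u * u * v = (r * r) • (v * u * u) := by
    rw [mul_assoc, h, mul_smul_comm, ← mul_assoc, h, smul_mul_assoc, smul_smul]
  have e2 : u * v * u = r • (v * u * u) := by rw [h, smul_mul_assoc]
  have e3 : u * v * v = (r * r) • (v * v * u) := by
    rw [h, smul_mul_assoc, mul_assoc, h, mul_smul_comm, smul_smul, mul_assoc]
  have e4 : v * u * v = r • (v * v * u) := by
    rw [mul_assoc, h, mul_smul_comm, mul_assoc]
  calc (u + v) ^ 3 = u ^ 3 + v ^ 3 + (u * u * v + u * v * u + v * u * u) +
        (u * v * v + v * u * v + v * v * u) := by noncomm_ring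
    _ = u ^ 3 + v ^ 3 + (r * r + r + 1) • (v * u * u) + (r * r + r + 1) • (v * v * u) := by
      rw [e1, e2, e3, e4]; simp only [add_smul, one_smul]
    _ = u ^ 3 + v ^ 3 := by simp [hs]

variable {a b c d : A}

theorem Rels.cube_a_mul_d (h : Rels cubicRoot a b c d) : a ^ 3 * d = d * a ^ 3 := by
  obtain ⟨ab, ac, bd, bc, cd, ad, da⟩ := h
  have hq : (cubicRoot : ℂ) ≠ 0 := cubicRoot.ne_zero
  have ax : a * (c * b) = ((cubicRoot : ℂ) ^ 2) • (c * b * a) := by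
    rw [← mul_assoc, ac, smul_mul_assoc, mul_assoc, ab, mul_smul_comm, smul_smul, mul_assoc, sq]
  have e1 : a ^ 3 * d = a ^ 2 + (cubicRoot : ℂ) ^ 5 • (c * b * a * a) := by
    calc a ^ 3 * d = a * (a * (a * d)) := by noncomm_ring
      _ = a ^ 2 + (cubicRoot : ℂ) • (a * (a * (c * b))) := by
        rw [ad]; simp [mul_add, sq]
      _ = _ := by
        rw [ax, mul_smul_comm, ← mul_assoc, ax]
        simp only [smul_mul_assoc, smul_smul]
        congr 2; ring
  have e2 : d * a ^ 3 = a ^ 2 + (cubicRoot : ℂ)⁻¹ • (c * b * a * a) := by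
    calc d * a ^ 3 = d * a * (a * a) := by noncomm_ring
      _ = _ := by rw [da]; simp [add_mul, sq, mul_assoc]
  rw [e1, e2]
  congr 2
  field_simp
  linear_combination ((cubicRoot : ℂ) ^ 3 + 1) * cubicRoot_pow

theorem Rels.cube_det (h : Rels cubicRoot a b c d) :
    a ^ 3 * d ^ 3 - b ^ 3 * c ^ 3 = 1 := by
  obtain ⟨ab, ac, bd, bc, cd, ad, da⟩ := h
  have ax : a * (c * b) = ((cubicRoot : ℂ) ^ 2) • (c * b * a) := by
    rw [← mul_assoc, ac, smul_mul_assoc, mul_assoc, ab, mul_smul_comm, smul_smul, mul_assoc, sq]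
  have e0 : b ^ 3 * c ^ 3 = (c * b) ^ 3 := by
    have hc : Commute b c := bc
    rw [← hc.mul_pow, bc]
  rw [e0]
  generalize c * b = x at ax ad
  have step : ∀ r : ℂ, a * (1 + r • x) * d =
      (1 + (r * (cubicRoot : ℂ) ^ 2) • x) * (1 + (cubicRoot : ℂ) • x) := fun r => by
    rw [mul_add, mul_smul_comm, ax, smul_smul, mul_one, add_mul, smul_mul_assoc, mul_assoc x, ad]
    simp only [add_mul, one_mul, smul_mul_assoc]
  have comm : ∀ r : ℂ, a * (1 + r • x) = (1 + (r * (cubicRoot : ℂ) ^ 2) • x) * a := fun r => by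
    rw [mul_add, mul_smul_comm, ax, smul_smul, mul_one, add_mul, smul_mul_assoc, one_mul]
  have s1 := step (cubicRoot : ℂ)
  have c3 := comm ((cubicRoot : ℂ) * (cubicRoot : ℂ) ^ 2)
  have h3 := cubicRoot_pow
  have h3' : (cubicRoot : ℂ) * (cubicRoot : ℂ) ^ 2 = 1 := by linear_combination h3
  rw [h3'] at s1 c3
  have : a ^ 3 * d ^ 3 = (1 + (cubicRoot : ℂ) ^ 2 • x) *
      ((1 + (1 : ℂ) • x) * (1 + (cubicRoot : ℂ) • x)) := by
    calc a ^ 3 * d ^ 3 = a * (a * (a * d) * d) * d := by noncomm_ring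
      _ = a * (1 + (1 : ℂ) • x) * ((1 + (cubicRoot : ℂ) • x) * d) := by
        rw [ad, s1]; noncomm_ring
      _ = (1 + (cubicRoot : ℂ) ^ 2 • x) * (a * (1 + (cubicRoot : ℂ) • x) * d) := by
        rw [c3, one_mul]; noncomm_ring
      _ = _ := by rw [s1]
  have expand : ∀ r s : ℂ, (1 + s • x) * ((1 + (1 : ℂ) • x) * (1 + r • x)) =
      1 + (s + 1 + r) • x + (s + r + s * r) • (x * x) + (s * r) • (x * x * x) := fun r s => by
    simp only [mul_add, add_mul, one_mul, mul_one, smul_mul_assoc, mul_smul_comm, one_smul,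
      mul_assoc]
    module
  have hs := cubicRoot_sum
  rw [this, expand, show (cubicRoot : ℂ) ^ 2 + 1 + cubicRoot = 0 by linear_combination hs,
    show (cubicRoot : ℂ) ^ 2 + cubicRoot + (cubicRoot : ℂ) ^ 2 * cubicRoot = 0 by
      linear_combination hs + h3,
    show (cubicRoot : ℂ) ^ 2 * cubicRoot = 1 by linear_combination h3]
  simp only [zero_smul, one_smul, add_zero]
  noncomm_ring

end cubes

theorem comul_T_cube (i j : Fin 2) :
    comul cubicRoot (T cubicRoot i j ^ 3) =
      (T cubicRoot i 0 ^ 3) ⊗ₜ[ℂ] (T cubicRoot 0 j ^ 3) +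
        (T cubicRoot i 1 ^ 3) ⊗ₜ[ℂ] (T cubicRoot 1 j ^ 3) := by
  obtain ⟨ab, ac, bd, bc, cd, ad, da⟩ := rels cubicRoot
  rw [map_pow, comul_T, add_cube_of_qcomm]
  · simp only [Algebra.TensorProduct.tmul_pow]
  · fin_cases i <;> fin_cases j <;>
      simp only [Fin.zero_eta, Fin.mk_one, Algebra.TensorProduct.tmul_mul_tmul, ab, ac, bd, cd,
        TensorProduct.tmul_smul, ← TensorProduct.smul_tmul', smul_smul, sq]

/-! ### The finite quantum group -/

/-- The two-sided ideal of `A(SL_q(2))`, `q = exp(2πi/3)`, generated by the elements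
`Tᵢⱼ³ - δᵢⱼ`. -/
def cubeTwoSidedIdeal : TwoSidedIdeal (SLq cubicRoot) :=
  TwoSidedIdeal.span {x | ∃ i j : Fin 2, x = T cubicRoot i j ^ 3 - if i = j then 1 else 0}

/-- The ideal `⟨Tᵢⱼ³ - δᵢⱼ⟩`. -/
def cubeIdeal : Ideal (SLq cubicRoot) := cubeTwoSidedIdeal.asIdeal

instance : cubeIdeal.IsTwoSided := inferInstanceAs (cubeTwoSidedIdeal.asIdeal.IsTwoSided)

theorem cubeIdeal_le_ker {R : Type*} [Ring R] [Algebra ℂ R] (f : SLq cubicRoot →ₐ[ℂ] R)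
    (h : ∀ i j, f (T cubicRoot i j) ^ 3 = if i = j then 1 else 0) {x : SLq cubicRoot}
    (hx : x ∈ cubeIdeal) : f x = 0 := by
  have hx' : x ∈ cubeTwoSidedIdeal := TwoSidedIdeal.mem_asIdeal.1 hx
  have hle : cubeTwoSidedIdeal ≤ TwoSidedIdeal.ker f := by
    refine TwoSidedIdeal.span_le.2 ?_
    rintro _ ⟨i, j, rfl⟩
    simp only [SetLike.mem_coe, TwoSidedIdeal.mem_ker, map_sub, map_pow, h, sub_eq_zero]
    split_ifs <;> simp
  exact (TwoSidedIdeal.mem_ker _).1 (hle hx')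

theorem mk_T_cube (i j : Fin 2) :
    Ideal.Quotient.mkₐ ℂ cubeIdeal (T cubicRoot i j) ^ 3 = if i = j then 1 else 0 := by
  have h : T cubicRoot i j ^ 3 - (if i = j then 1 else 0) ∈ cubeIdeal :=
    TwoSidedIdeal.mem_asIdeal.2 (TwoSidedIdeal.subset_span ⟨i, j, rfl⟩)
  have h2 := Ideal.Quotient.eq.2 h
  rw [← map_pow]
  refine h2.trans ?_
  split_ifs <;> simp

/-- The ideal `⟨Tᵢⱼ³ - δᵢⱼ⟩` is a Hopf ideal. -/
instance : cubeIdeal.IsHopfIdeal ℂ where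
  counit_eq_zero x hx := by
    refine cubeIdeal_le_ker (counit cubicRoot) (fun i j => ?_) hx
    rw [counit_T]; split_ifs <;> simp
  map_mkQ_comul_eq_zero x hx := by
    refine cubeIdeal_le_ker ((Algebra.TensorProduct.map (Ideal.Quotient.mkₐ ℂ cubeIdeal)
      (Ideal.Quotient.mkₐ ℂ cubeIdeal)).comp (comul cubicRoot)) (fun i j => ?_) hx
    rw [← map_pow, AlgHom.comp_apply, comul_T_cube]
    simp only [map_add, Algebra.TensorProduct.map_tmul, map_pow, mk_T_cube]
    fin_cases i <;> fin_cases j <;> simp [Algebra.TensorProduct.one_def]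
  antipode_mem x hx := by
    have key := cubeIdeal_le_ker (((Ideal.Quotient.mkₐ ℂ cubeIdeal).op).comp
      (antipodeAlgHom cubicRoot)) (fun i j => ?_) hx
    · exact Ideal.Quotient.eq_zero_iff_mem.1 (congrArg MulOpposite.unop key)
    · have h : Ideal.Quotient.mkₐ ℂ cubeIdeal (antipodeT cubicRoot i j) ^ 3 =
          if i = j then 1 else 0 := by
        have h3 : Odd 3 := by decide
        fin_cases i <;> fin_cases j <;>
          simp [-Ideal.Quotient.mkₐ_eq_mk, antipodeT, mk_T_cube, h3.neg_pow, smul_pow]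
      apply MulOpposite.unop_injective
      simp only [AlgHom.comp_apply, antipodeAlgHom, lift_T]
      refine Eq.trans h ?_
      split_ifs <;> rfl

/-- The Hopf algebra `A(F) = A(SL_q(2)) / ⟨Tᵢⱼ³ - δᵢⱼ⟩`, where `q = exp(2πi/3)`. -/
abbrev AF : Type := SLq cubicRoot ⧸ cubeIdeal

/-- The canonical surjection `π_F : A(SL_q(2)) → A(F)`. -/
def piF : SLq cubicRoot →ₐc[ℂ] AF := Bialgebra.Quotient.mkBialgHom cubeIdeal

/-- The `A(F)`-comodule algebra `A(SL_q(2))`, with coaction `(id ⊗ π_F) ∘ Δ`. -/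
def comoduleAlgebra : RightComoduleAlgebra ℂ AF (SLq cubicRoot) :=
  RightComoduleAlgebra.ofBialgHom piF

/-! ### The Frobenius map -/

/-- The ideal generated by `det - 1` in the polynomial ring in the entries of a `2 × 2` matrix. -/
def detIdeal : Ideal (MvPolynomial (Fin 2 × Fin 2) ℂ) :=
  Ideal.span {(Matrix.mvPolynomialX (Fin 2) (Fin 2) ℂ).det - 1}

/-- The coordinate ring `A(SL(2,ℂ)) = ℂ[x₀₀, x₀₁, x₁₀, x₁₁] / (x₀₀ x₁₁ - x₀₁ x₁₀ - 1)`. -/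
abbrev SL2Coord : Type := MvPolynomial (Fin 2 × Fin 2) ℂ ⧸ detIdeal

/-- The set of the cubes of the generators of `A(SL_q(2))`. -/
def cubes : Set (SLq cubicRoot) := Set.range fun ij : Fin 2 × Fin 2 => T cubicRoot ij.1 ij.2 ^ 3

theorem cubes_commute : ∀ x ∈ cubes, ∀ y ∈ cubes, x * y = y * x := by
  have h := rels cubicRoot
  have ab : Commute (T cubicRoot 0 0 ^ 3) (T cubicRoot 0 1) := cube_mul_of_qcomm h.ab
  have ac : Commute (T cubicRoot 0 0 ^ 3) (T cubicRoot 1 0) := cube_mul_of_qcomm h.ac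
  have bd : Commute (T cubicRoot 0 1 ^ 3) (T cubicRoot 1 1) := cube_mul_of_qcomm h.bd
  have cd : Commute (T cubicRoot 1 0 ^ 3) (T cubicRoot 1 1) := cube_mul_of_qcomm h.cd
  have bc : Commute (T cubicRoot 0 1) (T cubicRoot 1 0) := h.bc
  have ad : Commute (T cubicRoot 0 0 ^ 3) (T cubicRoot 1 1) := h.cube_a_mul_d
  rintro _ ⟨⟨i, j⟩, rfl⟩ _ ⟨⟨k, l⟩, rfl⟩
  fin_cases i <;> fin_cases j <;> fin_cases k <;> fin_cases l <;> first
    | rfl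
    | exact (ab.pow_right 3).eq
    | exact (ab.pow_right 3).eq.symm
    | exact (ac.pow_right 3).eq
    | exact (ac.pow_right 3).eq.symm
    | exact (bd.pow_right 3).eq
    | exact (bd.pow_right 3).eq.symm
    | exact (cd.pow_right 3).eq
    | exact (cd.pow_right 3).eq.symm
    | exact (bc.pow_pow 3 3).eq
    | exact (bc.pow_pow 3 3).eq.symm
    | exact (ad.pow_right 3).eq
    | exact (ad.pow_right 3).eq.symm

/-- The cubes of the generators commute with each other. -/
instance : IsMulCommutative (Algebra.adjoin ℂ cubes) :=
  Algebra.isMulCommutative_adjoin ℂ cubes_commute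

/-- The Frobenius map into the commutative subalgebra generated by the cubes. -/
def frobeniusAux : SL2Coord →ₐ[ℂ] Algebra.adjoin ℂ cubes :=
  Ideal.Quotient.liftₐ detIdeal
    (MvPolynomial.aeval fun ij : Fin 2 × Fin 2 =>
      (⟨T cubicRoot ij.1 ij.2 ^ 3, Algebra.subset_adjoin ⟨ij, rfl⟩⟩ : Algebra.adjoin ℂ cubes))
    (by
      intro x hx
      refine (Ideal.span_le (I := RingHom.ker (MvPolynomial.aeval fun ij : Fin 2 × Fin 2 =>
        (⟨T cubicRoot ij.1 ij.2 ^ 3, Algebra.subset_adjoin ⟨ij, rfl⟩⟩ :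
          Algebra.adjoin ℂ cubes)))).2 ?_ hx
      rintro _ rfl
      refine Subtype.ext ?_
      simpa [Matrix.det_fin_two, sub_eq_zero] using (rels cubicRoot).cube_det)

/-- The Frobenius map `Fr : A(SL(2,ℂ)) → A(SL_q(2))`, the homomorphism of algebras that sends the
coordinate function `xᵢⱼ` to `Tᵢⱼ³`. -/
def frobenius : SL2Coord →ₐ[ℂ] SLq cubicRoot := (Algebra.adjoin ℂ cubes).val.comp frobeniusAux

theorem frobenius_X (i j : Fin 2) :
    frobenius (Ideal.Quotient.mk detIdeal (MvPolynomial.X (i, j))) = T cubicRoot i j ^ 3 :=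
  congrArg Subtype.val (MvPolynomial.aeval_X (R := ℂ) _ (i, j))

/-- The image of the Frobenius map is commutative, being the image of a commutative algebra. -/
instance : IsMulCommutative frobenius.range :=
  .of_setLike_mul_comm fun _ hx _ hy => by
    obtain ⟨x, rfl⟩ := hx
    obtain ⟨y, rfl⟩ := hy
    exact (map_mul frobenius x y).symm.trans
      ((congrArg frobenius (mul_comm x y)).trans (map_mul frobenius y x))

end SLq

end

/-! Write `P` for the quantum group, `H` for `AF`, `B` for the image of the Frobenius map and `π`
for `piF`. The proof has two independent halves: a formal Hopf-algebraic argument that reduces the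
Galois property to a `B`-linear retraction of `P` onto `B`, and an explicit basis of 27 elements,
containing `1`, of `P` over `B`.

Galois property. For any Hopf algebra `P` the map `p ⊗ h ↦ p h₁ ⊗ h₂` is invertible, with inverse
`galoisInv`. The map `preCan` is this bijection followed by `id ⊗ π`, hence surjective, and its
kernel is `galoisInv (P ⊗ ker π)`. The cubes `Tᵢⱼ³` are central, so `ker π` is generated by the
`Tᵢⱼ³ - δᵢⱼ` already as a one-sided ideal; since `Δ Tᵢⱼ³ = ∑ₖ Tᵢₖ³ ⊗ Tₖⱼ³`, the antipode identity
shows that `galoisInv` carries these elements into the balancing relations over `B`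
(`ker_preCan_le`). This gives injectivity of the canonical map once the coinvariants are known to be
`B`. If `p` is coinvariant, then `1 ⊗ p - p ⊗ 1` lies in that kernel, and a left `B`-linear
retraction `r` turns this into `p = r p ∈ B`.

Basis. Over `B`, `P` is spanned by `w bʲ cᵏ` with `w ∈ {1, a, a², d, d²}` and `j, k < 3`. Giving `a`
degree `1`, `d` degree `-1` and `b`, `c` degree `0` modulo 3 sorts these into the families of `1`,
of `{a, d²}` and of `{d, a²}`. In each of the last two, relations over `B` cut 18 monomials down to
9 (`block_mem`). Independence is tested by letting `P` act on rational functions in `x, y, z`: the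
cubes act by multiplication by functions invariant under scaling each variable by `q`, and applying
a relation to the vector `1` gives an identity that is separated by eigenvalues of the three
scalings. The action of `B` is faithful (`eq_zero_of_rep_eq_zero`), so the coefficients vanish in
`B` itself.

A free module over `B` with nonzero total space is faithfully flat, the coordinate along the basis
vector `1` is the required retraction, and centrality of `B` makes left and right module structures
agree. -/

noncomputable section

/-! ## The Galois map of a Hopf algebra -/

namespace HopfAlgebra

variable (k P : Type*) [CommRing k] [Ring P] [HopfAlgebra k P]

/-- The linear map `P ⊗ P → P ⊗ P`, `p ⊗ h ↦ p S(h₍₁₎) ⊗ h₍₂₎`. -/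
def galoisInv : P ⊗[k] P →ₗ[k] P ⊗[k] P :=
  LinearMap.mul' k (P ⊗[k] P) ∘ₗ TensorProduct.map
    (Algebra.TensorProduct.includeLeft : P →ₐ[k] P ⊗[k] P).toLinearMap
    ((antipode k).rTensor P ∘ₗ Coalgebra.comul)

variable {k P}

theorem galoisInv_tmul (p h : P) :
    galoisInv k P (p ⊗ₜ h) = (p ⊗ₜ[k] 1) * (antipode k).rTensor P (Coalgebra.comul h) := by
  simp [galoisInv]

/-- Coassociativity turns the left side into `p h₁ S(h₂) ⊗ h₃`, and the antipode and counit axioms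
collapse it. -/
theorem galoisInv_mul_comul (p h : P) :
    galoisInv k P ((p ⊗ₜ[k] 1) * Coalgebra.comul h) = p ⊗ₜ h := by
  have key : galoisInv k P ∘ₗ LinearMap.mulLeft k (p ⊗ₜ[k] (1 : P)) =
      LinearMap.mulLeft k (p ⊗ₜ[k] (1 : P)) ∘ₗ
        (LinearMap.mul' k P ∘ₗ (antipode k).lTensor P).rTensor P ∘ₗ
        (TensorProduct.assoc k P P P).symm.toLinearMap ∘ₗ Coalgebra.comul.lTensor P := by
    refine TensorProduct.ext' fun x y => ?_
    simp only [LinearMap.comp_apply, LinearMap.mulLeft_apply, Algebra.TensorProduct.tmul_mul_tmul,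
      one_mul, galoisInv_tmul, LinearMap.lTensor_tmul, LinearEquiv.coe_coe]
    generalize (Coalgebra.comul y : P ⊗[k] P) = z
    induction z with
    | zero => simp
    | add z w hz hw => simp only [map_add, mul_add, TensorProduct.tmul_add, hz, hw]
    | tmul z w => simp [mul_assoc]
  have h1 := LinearMap.congr_fun key (Coalgebra.comul h)
  simp only [LinearMap.comp_apply, LinearMap.mulLeft_apply] at h1
  rw [h1, ← Coalgebra.coassoc_apply]
  simp only [LinearEquiv.coe_coe, LinearEquiv.symm_apply_apply, ← LinearMap.rTensor_comp_apply,
    LinearMap.comp_assoc, mul_antipode_lTensor_comul]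
  rw [LinearMap.rTensor_comp_apply, Coalgebra.rTensor_counit_comul]
  simp

/-- The mirror computation: `p S(h₁) h₂ ⊗ h₃ = p ⊗ h`. -/
theorem mul_comul_galoisInv (p h : P) :
    LinearMap.mul' k (P ⊗[k] P) (TensorProduct.map
      (Algebra.TensorProduct.includeLeft : P →ₐ[k] P ⊗[k] P).toLinearMap Coalgebra.comul
      (galoisInv k P (p ⊗ₜ h))) = p ⊗ₜ h := by
  have key : LinearMap.mul' k (P ⊗[k] P) ∘ₗ TensorProduct.map
        (Algebra.TensorProduct.includeLeft : P →ₐ[k] P ⊗[k] P).toLinearMap Coalgebra.comul ∘ₗ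
        LinearMap.mulLeft k (p ⊗ₜ[k] (1 : P)) ∘ₗ (antipode k).rTensor P =
      LinearMap.mulLeft k (p ⊗ₜ[k] (1 : P)) ∘ₗ
        (LinearMap.mul' k P ∘ₗ (antipode k).rTensor P).rTensor P ∘ₗ
        (TensorProduct.assoc k P P P).symm.toLinearMap ∘ₗ Coalgebra.comul.lTensor P := by
    refine TensorProduct.ext' fun x y => ?_
    simp only [LinearMap.comp_apply, LinearMap.mulLeft_apply, Algebra.TensorProduct.tmul_mul_tmul,
      one_mul, LinearMap.rTensor_tmul, LinearMap.lTensor_tmul, LinearEquiv.coe_coe,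
      TensorProduct.map_tmul, LinearMap.mul'_apply]
    generalize (Coalgebra.comul y : P ⊗[k] P) = z
    induction z with
    | zero => simp
    | add z w hz hw => simp only [map_add, mul_add, TensorProduct.tmul_add, hz, hw]
    | tmul z w => simp [mul_assoc]
  have h1 := LinearMap.congr_fun key (Coalgebra.comul h)
  simp only [LinearMap.comp_apply, LinearMap.mulLeft_apply] at h1
  rw [galoisInv_tmul, h1, ← Coalgebra.coassoc_apply]
  simp only [LinearEquiv.coe_coe, LinearEquiv.symm_apply_apply, ← LinearMap.rTensor_comp_apply,
    LinearMap.comp_assoc, mul_antipode_rTensor_comul]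
  rw [LinearMap.rTensor_comp_apply, Coalgebra.rTensor_counit_comul]
  simp

end HopfAlgebra

/-! ### The canonical map of a quotient Hopf algebra. -/

namespace RightComoduleAlgebra

variable {k H P : Type*} [CommRing k] [Ring H] [HopfAlgebra k H] [Ring P] [HopfAlgebra k P]

theorem ofBialgHom_coact (π : P →ₐc[k] H) (p : P) :
    (ofBialgHom π).coact p =
      (π : P →ₐ[k] H).toLinearMap.lTensor P (Coalgebra.comul p) := rfl

theorem preCan_ofBialgHom (π : P →ₐc[k] H) (t : P ⊗[k] P) :
    (ofBialgHom π).preCan t = (π : P →ₐ[k] H).toLinearMap.lTensor P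
      (LinearMap.mul' k (P ⊗[k] P) (TensorProduct.map
        (Algebra.TensorProduct.includeLeft : P →ₐ[k] P ⊗[k] P).toLinearMap Coalgebra.comul t)) := by
  induction t with
  | zero => simp
  | add s t hs ht => simp only [map_add, hs, ht]
  | tmul p h =>
    rw [preCan_tmul, ofBialgHom_coact]
    simp only [TensorProduct.map_tmul, LinearMap.mul'_apply, AlgHom.toLinearMap_apply,
      Algebra.TensorProduct.includeLeft_apply]
    generalize (Coalgebra.comul h : P ⊗[k] P) = z
    induction z with
    | zero => simp
    | add z w hz hw => simp only [map_add, mul_add, hz, hw]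
    | tmul z w => simp

theorem preCan_ofBialgHom_surjective (π : P →ₐc[k] H) (hπ : Function.Surjective π) :
    Function.Surjective (ofBialgHom π).preCan := by
  intro y
  obtain ⟨t, rfl⟩ := LinearMap.lTensor_surjective P
    (g := (π : P →ₐ[k] H).toLinearMap) hπ y
  refine ⟨HopfAlgebra.galoisInv k P t, ?_⟩
  rw [preCan_ofBialgHom]
  congr 1
  induction t with
  | zero => simp
  | add s t hs ht => simp only [map_add, hs, ht]
  | tmul p h => exact HopfAlgebra.mul_comul_galoisInv p h

theorem galoisInv_mul_map (t : P ⊗[k] P) : HopfAlgebra.galoisInv k P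
    (LinearMap.mul' k (P ⊗[k] P) (TensorProduct.map
      (Algebra.TensorProduct.includeLeft : P →ₐ[k] P ⊗[k] P).toLinearMap Coalgebra.comul t)) =
    t := by
  induction t with
  | zero => simp
  | add s t hs ht => simp only [map_add, hs, ht]
  | tmul p h => simpa using HopfAlgebra.galoisInv_mul_comul (k := k) p h

/-- By right exactness the kernel of `id ⊗ π` is the image of `P ⊗ ker π`; transporting it back
through the inverse Galois map gives the kernel of `preCan`. -/
theorem ker_preCan_ofBialgHom_le (π : P →ₐc[k] H) (hπ : Function.Surjective π)
    (N : Submodule k (P ⊗[k] P))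
    (hN : ∀ p h : P, π h = 0 → HopfAlgebra.galoisInv k P (p ⊗ₜ h) ∈ N) :
    LinearMap.ker (ofBialgHom π).preCan ≤ N := by
  intro t ht
  rw [LinearMap.mem_ker, preCan_ofBialgHom] at ht
  have hex := lTensor_exact P
    (LinearMap.exact_subtype_ker_map (π : P →ₐ[k] H).toLinearMap) hπ
  obtain ⟨s, hs⟩ := (hex _).1 ht
  rw [← galoisInv_mul_map t, ← hs]
  clear hs ht
  induction s with
  | zero => simp
  | add s t hs ht => simpa only [map_add] using N.add_mem hs ht
  | tmul p h => exact hN p h h.2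

end RightComoduleAlgebra

/-! ### Balancing relations and descent along a retraction. -/

section

variable {k P : Type*} [CommRing k] [Ring P] [Algebra k P]

theorem balancingRelations_mul_right {B : Subalgebra k P} {t : P ⊗[k] P}
    (ht : t ∈ balancingRelations B) (y : P) : t * (1 ⊗ₜ y) ∈ balancingRelations B := by
  induction ht using Submodule.span_induction with
  | mem t ht =>
    obtain ⟨p, b, p', rfl⟩ := ht
    exact Submodule.subset_span ⟨p, b, p' * y, by simp [sub_mul, mul_assoc]⟩
  | zero => simp
  | add s t _ _ hs ht => simpa only [add_mul] using add_mem hs ht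
  | smul r t _ ht => simpa only [smul_mul_assoc] using Submodule.smul_mem _ r ht

/-- A left linear retraction onto `B` detects the elements `p` with `1 ⊗ p = p ⊗ 1` in
`P ⊗_B P`. -/
theorem mem_of_tmul_sub_tmul_mem_balancingRelations {B : Subalgebra k P} (r : P →ₗ[B] B)
    (hr : r 1 = 1) {p : P} (hp : 1 ⊗ₜ[k] p - p ⊗ₜ[k] 1 ∈ balancingRelations B) : p ∈ B := by
  -- The map `p ⊗ p' ↦ p · r(p')` kills the balancing relations because `r` is left `B`-linear; on
  -- `1 ⊗ p - p ⊗ 1` its value is `r p - p`.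
  let f : P ⊗[k] P →ₗ[k] P := LinearMap.mul' k P ∘ₗ
    (B.val.toLinearMap ∘ₗ r.restrictScalars k).lTensor P
  have hf : balancingRelations B ≤ LinearMap.ker f := by
    refine Submodule.span_le.2 ?_
    rintro _ ⟨x, b, y, rfl⟩
    have hb : r ((b : P) * y) = b * r y := r.map_smul b y
    simp [f, hb, mul_assoc]
  have h := hf hp
  simp only [LinearMap.mem_ker, map_sub, f, LinearMap.comp_apply, LinearMap.lTensor_tmul,
    LinearMap.mul'_apply, LinearMap.restrictScalars_apply, hr, AlgHom.toLinearMap_apply, map_one,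
    one_mul, mul_one, sub_eq_zero] at h
  rw [← h]
  exact (r p).2

end

/-! ### Centrality of the cubes. -/

namespace SLq

section cubes

variable {A : Type*} [Ring A] [Algebra ℂ A]

theorem mul_cube_of_qcomm {x y : A} (h : x * y = (cubicRoot : ℂ) • (y * x)) :
    x * y ^ 3 = y ^ 3 * x := by
  have h' : MulOpposite.op y * MulOpposite.op x =
      (cubicRoot : ℂ) • (MulOpposite.op x * MulOpposite.op y) :=
    MulOpposite.unop_injective h
  exact congrArg MulOpposite.unop (cube_mul_of_qcomm h')

variable {a b c d : A}

/-- Exchanging `a` and `d` gives the relations in the opposite algebra. -/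
theorem Rels.op {q : ℂˣ} (h : Rels q a b c d) :
    Rels q (MulOpposite.op d) (MulOpposite.op b) (MulOpposite.op c) (MulOpposite.op a) where
  ab := MulOpposite.unop_injective h.bd
  ac := MulOpposite.unop_injective h.cd
  bd := MulOpposite.unop_injective h.ab
  bc := MulOpposite.unop_injective h.bc.symm
  cd := MulOpposite.unop_injective h.ac
  ad := MulOpposite.unop_injective (by simpa [h.bc] using h.ad)
  da := MulOpposite.unop_injective (by simpa [h.bc] using h.da)

theorem Rels.cube_d_mul_a (h : Rels cubicRoot a b c d) : d ^ 3 * a = a * d ^ 3 :=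
  congrArg MulOpposite.unop h.op.cube_a_mul_d.symm

end cubes

/-- It suffices to test generators: moving a generator past the cube of one it `q`-commutes with
costs `q³ = 1` or its inverse, and the pair `a, d` is handled by the determinant relations. -/
theorem cube_comm (i j : Fin 2) (x : SLq cubicRoot) :
    T cubicRoot i j ^ 3 * x = x * T cubicRoot i j ^ 3 := by
  have h := rels cubicRoot
  have hbc : Commute (T cubicRoot 0 1) (T cubicRoot 1 0) := h.bc
  induction x using SLq.induction with
  | hr r => exact (Algebra.commutes r _).symm
  | hadd x y hx hy => rw [mul_add, add_mul, hx, hy]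
  | hmul x y hx hy => rw [← mul_assoc, hx, mul_assoc, hy, mul_assoc]
  | hT k l =>
    fin_cases i <;> fin_cases j <;> fin_cases k <;> fin_cases l <;> first
      | exact ((Commute.refl _).pow_left 3).eq
      | exact cube_mul_of_qcomm h.ab
      | exact cube_mul_of_qcomm h.ac
      | exact cube_mul_of_qcomm h.bd
      | exact cube_mul_of_qcomm h.cd
      | exact (mul_cube_of_qcomm h.ab).symm
      | exact (mul_cube_of_qcomm h.ac).symm
      | exact (mul_cube_of_qcomm h.bd).symm
      | exact (mul_cube_of_qcomm h.cd).symm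
      | exact (hbc.pow_left 3).eq
      | exact (hbc.symm.pow_left 3).eq
      | exact h.cube_a_mul_d
      | exact h.cube_d_mul_a

theorem cube_mem_range (i j : Fin 2) : T cubicRoot i j ^ 3 ∈ frobenius.range :=
  ⟨_, frobenius_X i j⟩

/-- Reduces every statement about the image of the Frobenius map that cuts out a subalgebra to the
four cubes. -/
theorem frobenius_range_le {S : Subalgebra ℂ (SLq cubicRoot)}
    (hS : ∀ i j, T cubicRoot i j ^ 3 ∈ S) : frobenius.range ≤ S := by
  rintro _ ⟨y, rfl⟩
  have h : (frobeniusAux y : SLq cubicRoot) ∈ Algebra.adjoin ℂ cubes := (frobeniusAux y).2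
  refine (Algebra.adjoin_le ?_ : _ ≤ S) h
  rintro _ ⟨ij, rfl⟩
  exact hS _ _

/-- The image of the Frobenius map is central. -/
theorem frobenius_range_comm {b : SLq cubicRoot} (hb : b ∈ frobenius.range) (x : SLq cubicRoot) :
    b * x = x * b := by
  have h := frobenius_range_le (S := Subalgebra.center ℂ (SLq cubicRoot))
    (fun i j => Subalgebra.mem_center_iff.2 fun x => (cube_comm i j x).symm) hb
  exact (Subalgebra.mem_center_iff.1 h x).symm

/-! ### The canonical map -/

theorem piF_T_cube (i j : Fin 2) : piF (T cubicRoot i j ^ 3) = if i = j then 1 else 0 := by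
  rw [map_pow]
  exact mk_T_cube i j

theorem frobenius_range_le_coinvariants : frobenius.range ≤ comoduleAlgebra.coinvariants := by
  refine frobenius_range_le fun i j => ?_
  rw [RightComoduleAlgebra.mem_coinvariants]
  refine (RightComoduleAlgebra.ofBialgHom_coact piF _).trans ?_
  have h : (Coalgebra.comul (T cubicRoot i j ^ 3) : SLq cubicRoot ⊗[ℂ] SLq cubicRoot) = _ :=
    comul_T_cube i j
  rw [h]
  have hp : ∀ i j, (piF : SLq cubicRoot →ₐ[ℂ] AF).toLinearMap (T cubicRoot i j ^ 3) =
    if i = j then 1 else 0 := piF_T_cube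
  simp only [map_add, LinearMap.lTensor_tmul, hp]
  fin_cases j <;> simp

/-- The generators are central, so the left ideal that they generate is already two-sided. -/
theorem cubeIdeal_le_span : cubeIdeal ≤
    Ideal.span {x | ∃ i j : Fin 2, x = T cubicRoot i j ^ 3 - if i = j then 1 else 0} := by
  set J := Ideal.span {x | ∃ i j : Fin 2, x = T cubicRoot i j ^ 3 - if i = j then 1 else 0}
  have hJ : J.IsTwoSided := ⟨fun {x} y hx => by
    induction hx using Submodule.span_induction with
    | zero => simp
    | add x z _ _ hx hz => rw [add_mul]; exact add_mem hx hz
    | smul r x _ hx => rw [smul_eq_mul, mul_assoc]; exact J.mul_mem_left r hx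
    | mem x hx =>
      obtain ⟨i, j, rfl⟩ := hx
      have : (T cubicRoot i j ^ 3 - if i = j then 1 else 0) * y =
          y * (T cubicRoot i j ^ 3 - if i = j then 1 else 0) := by
        split_ifs <;> simp [sub_mul, mul_sub, cube_comm]
      rw [this]
      exact J.mul_mem_left y (Ideal.subset_span ⟨i, j, rfl⟩)⟩
  intro x hx
  refine Ideal.Quotient.eq_zero_iff_mem.1 (cubeIdeal_le_ker (Ideal.Quotient.mkₐ ℂ J)
    (fun i j => ?_) hx)
  have hij : T cubicRoot i j ^ 3 - (if i = j then 1 else 0) ∈ J := Ideal.subset_span ⟨i, j, rfl⟩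
  rw [← map_pow]
  refine (Ideal.Quotient.eq.2 hij).trans ?_
  split_ifs <;> simp

open HopfAlgebra in
-- Since `S` reverses products, `p S(h₁x₁) ⊗ h₂x₂ = (p S(x₁) S(h₁) ⊗ h₂)(1 ⊗ x₂)`: a right factor
-- `x` only changes `p` and multiplies the second leg on the right, an operation that preserves
-- balancing relations.
theorem galoisInv_mul (p h x : SLq cubicRoot) (X : SLq cubicRoot ⊗[ℂ] SLq cubicRoot)
    (hX : Coalgebra.comul (R := ℂ) x = X) :
    galoisInv ℂ _ (p ⊗ₜ (h * x)) = LinearMap.mul' ℂ (SLq cubicRoot ⊗[ℂ] SLq cubicRoot)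
      (TensorProduct.map
        (galoisInv ℂ _ ∘ₗ (TensorProduct.mk ℂ _ _).flip h ∘ₗ LinearMap.mulLeft ℂ p ∘ₗ
          HopfAlgebra.antipode ℂ)
        (Algebra.TensorProduct.includeRight :
          SLq cubicRoot →ₐ[ℂ] SLq cubicRoot ⊗[ℂ] SLq cubicRoot).toLinearMap X) := by
  rw [galoisInv_tmul, Bialgebra.comul_mul, hX]
  clear hX
  induction X with
  | zero => simp
  | add X Y hX hY => simp only [mul_add, map_add, hX, hY]
  | tmul y z =>
    simp only [TensorProduct.map_tmul, LinearMap.comp_apply, LinearMap.mulLeft_apply,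
      LinearMap.flip_apply, TensorProduct.mk_apply, galoisInv_tmul, LinearMap.mul'_apply,
      AlgHom.toLinearMap_apply, Algebra.TensorProduct.includeRight_apply]
    generalize (Coalgebra.comul h : SLq cubicRoot ⊗[ℂ] SLq cubicRoot) = w
    induction w with
    | zero => simp
    | add v w hv hw => simp only [add_mul, mul_add, map_add, hv, hw]
    | tmul v w => simp [antipode_eq, antipode_mul, mul_assoc]

open HopfAlgebra in
theorem galoisInv_mul_mem {N : Submodule ℂ (SLq cubicRoot ⊗[ℂ] SLq cubicRoot)}
    (hN : ∀ t ∈ N, ∀ y, t * (1 ⊗ₜ y) ∈ N) {h : SLq cubicRoot}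
    (hh : ∀ p, galoisInv ℂ _ (p ⊗ₜ h) ∈ N) (p x : SLq cubicRoot) :
    galoisInv ℂ _ (p ⊗ₜ (h * x)) ∈ N := by
  rw [galoisInv_mul p h x _ rfl]
  generalize (Coalgebra.comul x : SLq cubicRoot ⊗[ℂ] SLq cubicRoot) = X
  induction X with
  | zero => simp
  | add X Y hX hY => simpa only [map_add] using add_mem hX hY
  | tmul y z => exact hN _ (hh _) z

open HopfAlgebra in
theorem galoisInv_tmul_cube_sub_mem (p : SLq cubicRoot) (i j : Fin 2) :
    galoisInv ℂ _ (p ⊗ₜ (T cubicRoot i j ^ 3 - if i = j then 1 else 0)) ∈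
      balancingRelations frobenius.range := by
  have hS : ∀ x : SLq cubicRoot, HopfAlgebra.antipode ℂ (x ^ 3) = (HopfAlgebra.antipode ℂ x) ^ 3 := fun x => by
    simp only [antipode_eq, pow_succ, pow_zero, one_mul, antipode_mul, mul_assoc]
  have h0 : ∀ x : SLq cubicRoot, ∀ i j, (x * T cubicRoot i j ^ 3) ⊗ₜ[ℂ] (1 : SLq cubicRoot) -
      x ⊗ₜ[ℂ] (T cubicRoot i j ^ 3) ∈ balancingRelations frobenius.range := fun x i j =>
    Submodule.subset_span ⟨x, ⟨_, cube_mem_range i j⟩, 1, by simp⟩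
  have hc : (Coalgebra.comul (T cubicRoot i j ^ 3) : SLq cubicRoot ⊗[ℂ] SLq cubicRoot) = _ :=
    comul_T_cube i j
  have h1 := mul_antipode_rTensor_comul_apply (R := ℂ) (T cubicRoot i j ^ 3)
  have he : Coalgebra.counit (R := ℂ) (T cubicRoot i j ^ 3) = if i = j then 1 else 0 := by
    rw [Bialgebra.counit_pow, coalgebra_counit_T]; split_ifs <;> simp
  rw [hc, he] at h1
  simp only [map_add, LinearMap.rTensor_tmul, LinearMap.mul'_apply] at h1
  -- The antipode axiom rewrites `δᵢⱼ` as `∑ₖ S(Tᵢₖ³) Tₖⱼ³`, so the difference becomes, up to sign,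
  -- a sum over `k` of balancing relations that move `Tₖⱼ³ ∈ B` across the tensor sign.
  have h2 : galoisInv ℂ _ (p ⊗ₜ[ℂ] (if i = j then 1 else 0 : SLq cubicRoot)) =
      (p * (HopfAlgebra.antipode ℂ (T cubicRoot i 0 ^ 3) * T cubicRoot 0 j ^ 3 +
        HopfAlgebra.antipode ℂ (T cubicRoot i 1 ^ 3) * T cubicRoot 1 j ^ 3)) ⊗ₜ[ℂ] 1 := by
    rw [h1]
    split_ifs <;> simp [galoisInv_tmul, Algebra.TensorProduct.one_def]
  rw [TensorProduct.tmul_sub, map_sub, h2, galoisInv_tmul, hc, ← neg_mem_iff]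
  convert add_mem (h0 (p * HopfAlgebra.antipode ℂ (T cubicRoot i 0 ^ 3)) 0 j)
    (h0 (p * HopfAlgebra.antipode ℂ (T cubicRoot i 1 ^ 3)) 1 j) using 1
  simp only [map_add, LinearMap.rTensor_tmul, mul_add, TensorProduct.add_tmul,
    Algebra.TensorProduct.tmul_mul_tmul, one_mul, mul_assoc]
  abel

theorem ker_preCan_le : LinearMap.ker comoduleAlgebra.preCan ≤
    balancingRelations frobenius.range := by
  refine RightComoduleAlgebra.ker_preCan_ofBialgHom_le piF Ideal.Quotient.mk_surjective _ ?_
  intro p h hh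
  have hI : h ∈ cubeIdeal := Ideal.Quotient.eq_zero_iff_mem.1 hh
  have hJ := cubeIdeal_le_span hI
  clear hI hh
  induction hJ using Submodule.closure_induction generalizing p with
  | zero => simp
  | add x y _ _ hx hy => simpa only [TensorProduct.tmul_add, map_add] using add_mem (hx p) (hy p)
  | smul_mem r x hx =>
    obtain ⟨i, j, rfl⟩ := hx
    -- Centrality moves the coefficient to the right, the side on which `galoisInv_mul_mem` absorbs
    -- it.
    have hr : r • (T cubicRoot i j ^ 3 - if i = j then 1 else 0) =
        (T cubicRoot i j ^ 3 - if i = j then 1 else 0) * r := by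
      split_ifs <;> simp [sub_mul, mul_sub, cube_comm]
    rw [hr]
    exact galoisInv_mul_mem (fun t ht => balancingRelations_mul_right ht)
      (fun p => galoisInv_tmul_cube_sub_mem p i j) p r

/-- The comodule algebra `A(SL_q(2))` is Galois over the image of the Frobenius map as soon as
there is a linear retraction onto this image. -/
theorem isGaloisExtension_of_retraction
    (r : SLq cubicRoot →ₗ[frobenius.range] frobenius.range) (hr : r 1 = 1) :
    comoduleAlgebra.IsGaloisExtension frobenius.range := by
  have hB : comoduleAlgebra.coinvariants = frobenius.range := by
    refine le_antisymm (fun p hp => ?_) frobenius_range_le_coinvariants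
    -- `preCan` sends `1 ⊗ p - p ⊗ 1` to `ρ(p) - p ⊗ 1`, which vanishes exactly for coinvariant `p`.
    refine mem_of_tmul_sub_tmul_mem_balancingRelations r hr (ker_preCan_le ?_)
    rw [RightComoduleAlgebra.mem_coinvariants] at hp
    simp [hp, ← Algebra.TensorProduct.one_def]
  refine ⟨hB, ?_, ?_⟩
  · rw [← LinearMap.ker_eq_bot, RightComoduleAlgebra.can, Submodule.ker_liftQ_eq_bot]
    rw [hB]
    exact ker_preCan_le
  · rw [← LinearMap.range_eq_top, RightComoduleAlgebra.can, Submodule.range_liftQ,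
      LinearMap.range_eq_top]
    exact RightComoduleAlgebra.preCan_ofBialgHom_surjective piF Ideal.Quotient.mk_surjective

/-! ### The algebra as a module over the image of the Frobenius map -/

/-- The cubes of the generators, as elements of the image of the Frobenius map. -/
def cube (i j : Fin 2) : frobenius.range := ⟨T cubicRoot i j ^ 3, cube_mem_range i j⟩

theorem cube_smul (i j : Fin 2) (x : SLq cubicRoot) : cube i j • x = T cubicRoot i j ^ 3 * x := rfl

theorem range_smul_def (r : frobenius.range) (x : SLq cubicRoot) :
    r • x = (r : SLq cubicRoot) * x := rfl

instance : SMulCommClass frobenius.range (SLq cubicRoot) (SLq cubicRoot) :=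
  ⟨fun r x y => by
    simp only [range_smul_def, smul_eq_mul, ← mul_assoc, frobenius_range_comm r.2 x]⟩

instance : IsScalarTower frobenius.range (SLq cubicRoot) (SLq cubicRoot) :=
  ⟨fun r x y => by simp only [range_smul_def, smul_eq_mul, mul_assoc]⟩

/-! ### Product formulas for powers of `a` and `d`. -/

section relations

variable {A : Type*} [Ring A] [Algebra ℂ A] {a b c d : A}

theorem Rels.a_mul_x (h : Rels cubicRoot a b c d) :
    a * (b * c) = ((cubicRoot : ℂ) ^ 2) • (b * c * a) := by
  rw [← mul_assoc, h.ab, smul_mul_assoc, mul_assoc, h.ac, mul_smul_comm, smul_smul, mul_assoc, sq]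

theorem Rels.x_mul_a (h : Rels cubicRoot a b c d) :
    b * c * a = (cubicRoot : ℂ) • (a * (b * c)) := by
  rw [h.a_mul_x, smul_smul, show (cubicRoot : ℂ) * (cubicRoot : ℂ) ^ 2 = 1 by
    linear_combination cubicRoot_pow, one_smul]

theorem Rels.x_mul_d (h : Rels cubicRoot a b c d) :
    b * c * d = ((cubicRoot : ℂ) ^ 2) • (d * (b * c)) := by
  rw [mul_assoc, h.cd, mul_smul_comm, ← mul_assoc, h.bd, smul_mul_assoc, smul_smul, mul_assoc, sq]

theorem Rels.a_mul_d_sq (h : Rels cubicRoot a b c d) : a * d ^ 2 = d + d * (b * c) := by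
  rw [sq, ← mul_assoc, h.ad, ← h.bc, add_mul, smul_mul_assoc, h.x_mul_d, smul_smul, one_mul,
    show (cubicRoot : ℂ) * (cubicRoot : ℂ) ^ 2 = 1 by linear_combination cubicRoot_pow, one_smul]

theorem Rels.d_mul_a_sq (h : Rels cubicRoot a b c d) : d * a ^ 2 = a + a * (b * c) := by
  rw [sq, ← mul_assoc, h.da, ← h.bc, add_mul, smul_mul_assoc, h.x_mul_a, smul_smul, one_mul,
    inv_mul_cancel₀ cubicRoot.ne_zero, one_smul]

theorem Rels.a_cube_mul_d (h : Rels cubicRoot a b c d) :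
    a ^ 3 * d = a ^ 2 + (cubicRoot : ℂ) • (a ^ 2 * (b * c)) := by
  rw [pow_succ, mul_assoc, h.ad, ← h.bc, mul_add, mul_one, mul_smul_comm]

theorem Rels.d_cube_mul_a (h : Rels cubicRoot a b c d) :
    d ^ 3 * a = d ^ 2 + (cubicRoot : ℂ)⁻¹ • (d ^ 2 * (b * c)) := by
  rw [pow_succ, mul_assoc, h.da, ← h.bc, mul_add, mul_one, mul_smul_comm]

/-- The right side is `a (1 + bc)(1 + q bc)`. It expresses `a³ · d²`, with `a³ ∈ B`, through the
monomials `a (bc)ⁱ`, and is one of the two relations linking `a` and `d²`; the other is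
`d_cube_mul_a`. -/
theorem Rels.a_cube_mul_d_sq (h : Rels cubicRoot a b c d) :
    a ^ 3 * d ^ 2 = a + (1 + (cubicRoot : ℂ)) • (a * (b * c)) +
      (cubicRoot : ℂ) • (a * (b * c) * (b * c)) := by
  have e : a ^ 3 * d ^ 2 = a * (a * (a * d ^ 2)) := by noncomm_ring
  rw [e, h.a_mul_d_sq, mul_add, ← mul_assoc a d, h.ad, ← h.bc, add_mul, one_mul, smul_mul_assoc]
  simp only [mul_add, mul_one, mul_smul_comm, mul_assoc]
  module

theorem Rels.d_cube_mul_a_sq (h : Rels cubicRoot a b c d) :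
    d ^ 3 * a ^ 2 = d + (1 + (cubicRoot : ℂ)⁻¹) • (d * (b * c)) +
      (cubicRoot : ℂ)⁻¹ • (d * (b * c) * (b * c)) := by
  have e : d ^ 3 * a ^ 2 = d * (d * (d * a ^ 2)) := by noncomm_ring
  rw [e, h.d_mul_a_sq, mul_add, ← mul_assoc d a, h.da, ← h.bc, add_mul, one_mul, smul_mul_assoc]
  simp only [mul_add, mul_one, mul_smul_comm, mul_assoc]
  module

end relations

/-! ### A generating set of 27 elements. -/

section monomials

local notation "a" => T cubicRoot 0 0
local notation "b" => T cubicRoot 0 1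
local notation "c" => T cubicRoot 1 0
local notation "d" => T cubicRoot 1 1

/-- The elements `1, a, a², d, d²`. -/
def diagPowers : Fin 5 → SLq cubicRoot := ![1, a, a ^ 2, d, d ^ 2]

theorem commute_bc : Commute b c := (rels cubicRoot).bc

theorem span_monomials_mul_right (u : Set (SLq cubicRoot)) {z : SLq cubicRoot}
    (hz : z ∈ Submodule.span frobenius.range {y | ∃ w ∈ u, ∃ j k : ℕ, y = w * (b ^ j * c ^ k)})
    (j k : ℕ) : z * (b ^ j * c ^ k) ∈
      Submodule.span frobenius.range {y | ∃ w ∈ u, ∃ j k : ℕ, y = w * (b ^ j * c ^ k)} := by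
  induction hz using Submodule.span_induction with
  | zero => simp
  | add x y _ _ hx hy => simpa only [add_mul] using add_mem hx hy
  | smul r x _ hx => simpa only [smul_mul_assoc] using Submodule.smul_mem _ r hx
  | mem x hx =>
    obtain ⟨w, hw, j', k', rfl⟩ := hx
    refine Submodule.subset_span ⟨w, hw, j' + j, k' + k, ?_⟩
    rw [mul_assoc, pow_add, pow_add]
    congr 1
    rw [mul_assoc, mul_assoc, ← mul_assoc (c ^ k'), ((commute_bc.symm.pow_pow k' j).eq), mul_assoc]

theorem span_diagPowers : Submodule.span frobenius.range
    {y | ∃ w ∈ Set.range diagPowers, ∃ j k : ℕ, y = w * (b ^ j * c ^ k)} = ⊤ := by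
  set N := Submodule.span frobenius.range
    {y | ∃ w ∈ Set.range diagPowers, ∃ j k : ℕ, y = w * (b ^ j * c ^ k)} with hN
  have hr : ∀ z ∈ N, ∀ j k : ℕ, z * (b ^ j * c ^ k) ∈ N := fun z hz =>
    span_monomials_mul_right _ hz
  have hw : ∀ i, diagPowers i ∈ N := fun i =>
    Submodule.subset_span ⟨_, ⟨i, rfl⟩, 0, 0, by simp⟩
  have w0 : (1 : SLq cubicRoot) ∈ N := hw 0
  have w1 : a ∈ N := hw 1
  have w2 : a ^ 2 ∈ N := hw 2
  have w3 : d ∈ N := hw 3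
  have w4 : d ^ 2 ∈ N := hw 4
  have hb : ∀ z ∈ N, z * b ∈ N := fun z hz => by simpa using hr z hz 1 0
  have hc : ∀ z ∈ N, z * c ∈ N := fun z hz => by simpa using hr z hz 0 1
  have hx : ∀ z ∈ N, z * (b * c) ∈ N := fun z hz => by simpa using hr z hz 1 1
  have hs : ∀ (s : ℂ), ∀ z ∈ N, s • z ∈ N := fun s z hz => N.smul_of_tower_mem s hz
  have hs' : ∀ {s : ℂ} {z}, s ≠ 0 → s • z ∈ N → z ∈ N := fun {s z} h0 hz => by
    simpa [smul_smul, h0] using hs s⁻¹ _ hz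
  have hq := cubicRoot.ne_zero
  have h := rels cubicRoot
  -- Left multiplication by `a` or `d` either stays among the five powers, produces a cube in `B`,
  -- or meets `ad` or `da` and leaves powers of `bc`; `b` and `c` pass to the right at the cost of
  -- powers of `q`.
  have key : ∀ i j k, T cubicRoot i j * diagPowers k ∈ N := by
    have aw : ∀ k, a * diagPowers k ∈ N := by
      refine Fin.forall_fin_succ.2 ⟨?_, Fin.forall_fin_succ.2 ⟨?_, Fin.forall_fin_succ.2 ⟨?_,
        Fin.forall_fin_succ.2 ⟨?_, Fin.forall_fin_succ.2 ⟨?_, fun i => i.elim0⟩⟩⟩⟩⟩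
      · change a * 1 ∈ N
        simpa using w1
      · change a * a ∈ N
        simpa [sq] using w2
      · change a * a ^ 2 ∈ N
        simpa [cube_smul, pow_succ, mul_assoc] using N.smul_mem (cube 0 0) w0
      · change a * d ∈ N
        rw [h.ad, ← h.bc]
        exact add_mem w0 (hs _ _ (by simpa using hx _ w0))
      · change a * d ^ 2 ∈ N
        rw [h.a_mul_d_sq]
        exact add_mem w3 (hx _ w3)
    have dw : ∀ k, d * diagPowers k ∈ N := by
      refine Fin.forall_fin_succ.2 ⟨?_, Fin.forall_fin_succ.2 ⟨?_, Fin.forall_fin_succ.2 ⟨?_,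
        Fin.forall_fin_succ.2 ⟨?_, Fin.forall_fin_succ.2 ⟨?_, fun i => i.elim0⟩⟩⟩⟩⟩
      · change d * 1 ∈ N
        simpa using w3
      · change d * a ∈ N
        rw [h.da, ← h.bc]
        exact add_mem w0 (hs _ _ (by simpa using hx _ w0))
      · change d * a ^ 2 ∈ N
        rw [h.d_mul_a_sq]
        exact add_mem w1 (hx _ w1)
      · change d * d ∈ N
        simpa [sq] using w4
      · change d * d ^ 2 ∈ N
        simpa [cube_smul, pow_succ, mul_assoc] using N.smul_mem (cube 1 1) w0
    have qw : ∀ z : SLq cubicRoot, (a * z = (cubicRoot : ℂ) • (z * a)) →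
        (z * d = (cubicRoot : ℂ) • (d * z)) → (∀ y ∈ N, y * z ∈ N) →
        ∀ k, z * diagPowers k ∈ N := by
      intro z haz hzd hz
      refine Fin.forall_fin_succ.2 ⟨?_, Fin.forall_fin_succ.2 ⟨?_, Fin.forall_fin_succ.2 ⟨?_,
        Fin.forall_fin_succ.2 ⟨?_, Fin.forall_fin_succ.2 ⟨?_, fun i => i.elim0⟩⟩⟩⟩⟩
      · change z * 1 ∈ N
        simpa using hz _ w0
      · change z * a ∈ N
        exact hs' hq (haz ▸ hz _ w1)
      · change z * a ^ 2 ∈ N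
        refine hs' (mul_ne_zero hq hq) ?_
        have e : a ^ 2 * z = ((cubicRoot : ℂ) * cubicRoot) • (z * a ^ 2) := by
          rw [sq, mul_assoc, haz, mul_smul_comm, ← mul_assoc, haz, smul_mul_assoc, smul_smul,
            mul_assoc]
        exact e ▸ hz _ w2
      · change z * d ∈ N
        rw [hzd]
        exact hs _ _ (hz _ w3)
      · change z * d ^ 2 ∈ N
        rw [sq, ← mul_assoc, hzd, smul_mul_assoc, mul_assoc, hzd, mul_smul_comm, ← mul_assoc, ← sq]
        exact hs _ _ (hs _ _ (hz _ w4))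
    intro i j
    fin_cases i <;> fin_cases j
    · exact aw
    · exact qw _ h.ab h.bd hb
    · exact qw _ h.ac h.cd hc
    · exact dw
  -- As `B` is central, `key` makes `N` a left ideal; it contains `1`.
  have left : ∀ x : SLq cubicRoot, ∀ z ∈ N, x * z ∈ N := by
    intro x
    induction x using SLq.induction with
    | hr r => intro z hz; rw [← Algebra.smul_def]; exact hs r z hz
    | hadd x y hx hy => intro z hz; rw [add_mul]; exact add_mem (hx z hz) (hy z hz)
    | hmul x y hx hy => intro z hz; rw [mul_assoc]; exact hx _ (hy z hz)
    | hT i j =>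
      intro z hz
      induction hz using Submodule.span_induction with
      | zero => simp
      | add x y _ _ hx hy => rw [mul_add]; exact add_mem hx hy
      | smul r x _ hx => rw [mul_smul_comm]; exact N.smul_mem r hx
      | mem x hx =>
        obtain ⟨_, ⟨l, rfl⟩, j', k', rfl⟩ := hx
        rw [← mul_assoc]
        exact hr _ (key i j l) j' k'
  exact Submodule.eq_top_iff'.2 fun x => by simpa using left x 1 w0

/-- The basis elements in a component generated by two elements `u` and `v`. -/
def blockBasis (u v : SLq cubicRoot) : Fin 3 → Fin 3 → SLq cubicRoot :=
  ![![u, u * c, u * c ^ 2], ![u * b, u * (b * c), v * c], ![u * b ^ 2, v * b, v]]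

theorem mul_monomials_mem {N : Submodule frobenius.range (SLq cubicRoot)} {u : SLq cubicRoot}
    (h : ∀ j k : Fin 3, u * (b ^ (j : ℕ) * c ^ (k : ℕ)) ∈ N) (j k : ℕ) :
    u * (b ^ j * c ^ k) ∈ N := by
  have e : u * (b ^ j * c ^ k) = cube 0 1 ^ (j / 3) • cube 1 0 ^ (k / 3) •
      (u * (b ^ (j % 3) * c ^ (k % 3))) := by
    rw [← mul_smul_comm, ← mul_smul_comm, ← mul_smul_comm, ← smul_mul_assoc]
    congr 1
    have h1 : (cube 0 1 ^ (j / 3)) • b ^ (j % 3) = b ^ j := by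
      rw [range_smul_def]
      change (b ^ 3) ^ (j / 3) * _ = _
      rw [← pow_mul, ← pow_add, Nat.div_add_mod]
    have h2 : (cube 1 0 ^ (k / 3)) • c ^ (k % 3) = c ^ k := by
      rw [range_smul_def]
      change (c ^ 3) ^ (k / 3) * _ = _
      rw [← pow_mul, ← pow_add, Nat.div_add_mod]
    rw [h1, h2]
  rw [e]
  exact N.smul_mem _ (N.smul_mem _
    (h ⟨j % 3, Nat.mod_lt _ (by norm_num)⟩ ⟨k % 3, Nat.mod_lt _ (by norm_num)⟩))

/-- Multiplying the two relations by `bʲ cᵏ` links monomials only along `(j, k) ↦ (j + 1, k + 1)`,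
so, with exponents read modulo 3 because `b³, c³ ∈ B`, the 18 monomials split into three diagonals
of six. `blockBasis` picks two `u`-monomials and one `v`-monomial on each. Every further monomial is
then solved for from a relation whose other terms are known; only the scalars `r, s, t` are ever
divided by, never `α` or `δ`. -/
theorem block_mem {N : Submodule frobenius.range (SLq cubicRoot)} {u v : SLq cubicRoot}
    {α δ : frobenius.range} {r s t : ℂ} (hr : r ≠ 0) (hs : s ≠ 0) (ht : t ≠ 0)
    (huv : α • v = u + r • (u * (b * c)) + s • (u * (b * c) * (b * c)))
    (hvu : δ • u = v + t • (v * (b * c)))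
    (hN : ∀ j k, blockBasis u v j k ∈ N) :
    (∀ j k : ℕ, u * (b ^ j * c ^ k) ∈ N) ∧ ∀ j k : ℕ, v * (b ^ j * c ^ k) ∈ N := by
  have hS : ∀ {s : ℂ} {z}, z ∈ N → s • z ∈ N := fun {s z} hz => N.smul_of_tower_mem s hz
  have hs' : ∀ {s : ℂ} {z}, s ≠ 0 → s • z ∈ N → z ∈ N := fun {s z} h0 hz => by
    simpa [smul_smul, h0] using hS (s := s⁻¹) hz
  have hx : ∀ j k : ℕ, (b * c) * (b ^ j * c ^ k) = b ^ (j + 1) * c ^ (k + 1) := fun j k => by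
    rw [pow_succ', pow_succ', mul_assoc, mul_assoc, ← mul_assoc c,
      (commute_bc.symm.pow_right j).eq, mul_assoc]
  have R1 : ∀ j k : ℕ, α • (v * (b ^ j * c ^ k)) = u * (b ^ j * c ^ k) +
      r • (u * (b ^ (j + 1) * c ^ (k + 1))) + s • (u * (b ^ (j + 2) * c ^ (k + 2))) := by
    intro j k
    rw [← smul_mul_assoc, huv]
    simp only [add_mul, smul_mul_assoc, mul_assoc u, mul_assoc (b * c), hx]
  have R2 : ∀ j k : ℕ, δ • (u * (b ^ j * c ^ k)) = v * (b ^ j * c ^ k) +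
      t • (v * (b ^ (j + 1) * c ^ (k + 1))) := by
    intro j k
    rw [← smul_mul_assoc, hvu]
    simp only [add_mul, smul_mul_assoc, mul_assoc v, hx]
  have u00 : u * (b ^ 0 * c ^ 0) ∈ N := by simpa [blockBasis] using hN 0 0
  have u01 : u * (b ^ 0 * c ^ 1) ∈ N := by simpa [blockBasis] using hN 0 1
  have u02 : u * (b ^ 0 * c ^ 2) ∈ N := by simpa [blockBasis] using hN 0 2
  have u10 : u * (b ^ 1 * c ^ 0) ∈ N := by simpa [blockBasis] using hN 1 0
  have u11 : u * (b ^ 1 * c ^ 1) ∈ N := by simpa [blockBasis] using hN 1 1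
  have v01 : v * (b ^ 0 * c ^ 1) ∈ N := by simpa [blockBasis] using hN 1 2
  have u20 : u * (b ^ 2 * c ^ 0) ∈ N := by simpa [blockBasis] using hN 2 0
  have v10 : v * (b ^ 1 * c ^ 0) ∈ N := by simpa [blockBasis] using hN 2 1
  have v00 : v * (b ^ 0 * c ^ 0) ∈ N := by simpa [blockBasis] using hN 2 2
  have cb3 : ∀ w, ∀ j k : ℕ, w * (b ^ j * c ^ k) ∈ N → w * (b ^ (j + 3) * c ^ k) ∈ N := by
    intro w j k h
    have e : w * (b ^ (j + 3) * c ^ k) = cube 0 1 • (w * (b ^ j * c ^ k)) := by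
      rw [← mul_smul_comm, ← smul_mul_assoc, cube_smul, ← pow_add, add_comm]
    exact e ▸ N.smul_mem _ h
  have cc3 : ∀ w, ∀ j k : ℕ, w * (b ^ j * c ^ k) ∈ N → w * (b ^ j * c ^ (k + 3)) ∈ N := by
    intro w j k h
    have e : w * (b ^ j * c ^ (k + 3)) = cube 1 0 • (w * (b ^ j * c ^ k)) := by
      rw [← mul_smul_comm, ← mul_smul_comm, cube_smul, ← pow_add, add_comm]
    exact e ▸ N.smul_mem _ h
  have A3 : ∀ j k : ℕ, v * (b ^ j * c ^ k) ∈ N → u * (b ^ j * c ^ k) ∈ N →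
      u * (b ^ (j + 1) * c ^ (k + 1)) ∈ N → u * (b ^ (j + 2) * c ^ (k + 2)) ∈ N := by
    intro j k h1 h2 h3
    refine hs' hs ?_
    have := N.smul_mem α h1
    rw [R1] at this
    exact (N.add_mem_iff_right (add_mem h2 (hS h3))).1 this
  have A2 : ∀ j k : ℕ, v * (b ^ j * c ^ k) ∈ N → u * (b ^ j * c ^ k) ∈ N →
      u * (b ^ (j + 2) * c ^ (k + 2)) ∈ N → u * (b ^ (j + 1) * c ^ (k + 1)) ∈ N := by
    intro j k h1 h2 h3
    refine hs' hr ?_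
    have := N.smul_mem α h1
    rw [R1] at this
    exact (N.add_mem_iff_right h2).1 ((N.add_mem_iff_left (hS h3)).1 this)
  have D2 : ∀ j k : ℕ, u * (b ^ j * c ^ k) ∈ N → v * (b ^ j * c ^ k) ∈ N →
      v * (b ^ (j + 1) * c ^ (k + 1)) ∈ N := by
    intro j k h1 h2
    refine hs' ht ?_
    have := N.smul_mem δ h1
    rw [R2] at this
    exact (N.add_mem_iff_right h2).1 this
  have D1 : ∀ j k : ℕ, u * (b ^ j * c ^ k) ∈ N → v * (b ^ (j + 1) * c ^ (k + 1)) ∈ N →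
      v * (b ^ j * c ^ k) ∈ N := by
    intro j k h1 h2
    have := N.smul_mem δ h1
    rw [R2] at this
    exact (N.add_mem_iff_left (hS h2)).1 this
  -- The subscripts are the exponents of `b` and `c`. Uses of `cb3` and `cc3` wrap a diagonal around
  -- the 3 × 3 grid.
  have u22 := A3 0 0 v00 u00 u11
  have v11 := D2 0 0 u00 v00
  have v22 := D2 1 1 u11 v11
  have u21 := A2 1 0 v10 u10 (cb3 _ 0 2 u02)
  have v21 := D2 1 0 u10 v10
  have v02 := D1 0 2 u02 (cc3 _ 1 0 v10)
  have u12 := A2 0 1 v01 u01 (cc3 _ 2 0 u20)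
  have v12 := D2 0 1 u01 v01
  have v20 := D1 2 0 u20 (cb3 _ 0 1 v01)
  constructor
  · refine mul_monomials_mem fun j k => ?_
    fin_cases j <;> fin_cases k <;> assumption
  · refine mul_monomials_mem fun j k => ?_
    fin_cases j <;> fin_cases k <;> assumption

/-- The members of the basis of `A(SL_q(2))` over the image of the Frobenius map. -/
def basisVec : Fin 3 → Fin 3 → Fin 3 → SLq cubicRoot :=
  ![fun j k => b ^ (j : ℕ) * c ^ (k : ℕ), blockBasis a (d ^ 2), blockBasis d (a ^ 2)]

theorem span_basisVec : Submodule.span frobenius.range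
    (Set.range fun i : Fin 3 × Fin 3 × Fin 3 => basisVec i.1 i.2.1 i.2.2) = ⊤ := by
  set N := Submodule.span frobenius.range
    (Set.range fun i : Fin 3 × Fin 3 × Fin 3 => basisVec i.1 i.2.1 i.2.2)
  have hN : ∀ i j k, basisVec i j k ∈ N := fun i j k => Submodule.subset_span ⟨(i, j, k), rfl⟩
  have h := rels cubicRoot
  have hq : (cubicRoot : ℂ) ≠ 0 := cubicRoot.ne_zero
  -- `1 + q = -q²`, a coefficient that `block_mem` must invert.
  have h1q : (1 + (cubicRoot : ℂ)) ≠ 0 := fun h0 => by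
    have := cubicRoot_sum
    rw [h0, zero_add] at this
    exact pow_ne_zero 2 hq this
  have h1q' : (1 + (cubicRoot : ℂ)⁻¹) ≠ 0 := fun h0 => h1q (by
    field_simp at h0
    linear_combination h0)
  have m0 : ∀ j k : ℕ, 1 * (b ^ j * c ^ k) ∈ N := mul_monomials_mem fun j k => by
    simpa [basisVec] using hN 0 j k
  obtain ⟨m1, m4⟩ := block_mem (u := a) (v := d ^ 2) (N := N) (α := cube 0 0) (δ := cube 1 1)
    h1q hq (inv_ne_zero hq) h.a_cube_mul_d_sq h.d_cube_mul_a (hN 1)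
  obtain ⟨m3, m2⟩ := block_mem (u := d) (v := a ^ 2) (N := N) (α := cube 1 1) (δ := cube 0 0)
    h1q' (inv_ne_zero hq) hq h.d_cube_mul_a_sq h.a_cube_mul_d (hN 2)
  rw [eq_top_iff, ← span_diagPowers]
  refine Submodule.span_le.2 ?_
  rintro _ ⟨_, ⟨l, rfl⟩, j, k, rfl⟩
  fin_cases l
  exacts [m0 j k, m1 j k, m2 j k, m3 j k, m4 j k]

end monomials

/-! ### A representation on a field of rational functions -/

/-- The field of rational functions in three variables. -/
abbrev RatFun : Type := FractionRing (MvPolynomial (Fin 3) ℂ)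

/-- The coordinate functions of `RatFun`. -/
def coord (i : Fin 3) : RatFun := algebraMap (MvPolynomial (Fin 3) ℂ) RatFun (MvPolynomial.X i)

theorem coord_ne_zero (i : Fin 3) : coord i ≠ 0 :=
  (map_ne_zero_iff _ (IsFractionRing.injective (MvPolynomial (Fin 3) ℂ) RatFun)).2
    (MvPolynomial.X_ne_zero i)

/-- The scaling of the `i`-th variable of a polynomial by the cubic root of unity. -/
def polyScale (i : Fin 3) : MvPolynomial (Fin 3) ℂ →ₐ[ℂ] MvPolynomial (Fin 3) ℂ :=
  MvPolynomial.aeval fun j => (if j = i then (cubicRoot : ℂ) else 1) • MvPolynomial.X j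

theorem polyScale_cube (i : Fin 3) (p : MvPolynomial (Fin 3) ℂ) :
    polyScale i (polyScale i (polyScale i p)) = p := by
  have h : ((polyScale i).comp (polyScale i)).comp (polyScale i) = AlgHom.id ℂ _ := by
    refine MvPolynomial.algHom_ext fun j => ?_
    have h3 : (cubicRoot : ℂ) * (cubicRoot * cubicRoot) = 1 := by
      linear_combination cubicRoot_pow
    simp only [polyScale, AlgHom.comp_apply, MvPolynomial.aeval_X, map_smul, smul_smul,
      AlgHom.id_apply]
    split_ifs <;> simp [h3]
  exact DFunLike.congr_fun h p

/-- Scaling has order three; injectivity is what lets it extend to the fraction field. -/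
theorem polyScale_injective (i : Fin 3) : Function.Injective (polyScale i) :=
  Function.LeftInverse.injective (g := fun p => polyScale i (polyScale i p)) (polyScale_cube i)

theorem algebraMap_polyScale_injective (i : Fin 3) : Function.Injective
    ((IsScalarTower.toAlgHom ℂ (MvPolynomial (Fin 3) ℂ) RatFun).comp (polyScale i)).toRingHom :=
  (IsFractionRing.injective (MvPolynomial (Fin 3) ℂ) RatFun).comp (polyScale_injective i)

/-- The scaling of the `i`-th variable of a rational function by the cubic root of unity. -/
def scale (i : Fin 3) : RatFun →ₐ[ℂ] RatFun :=
  IsFractionRing.liftAlgHom (A := MvPolynomial (Fin 3) ℂ)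
    (g := (IsScalarTower.toAlgHom ℂ (MvPolynomial (Fin 3) ℂ) RatFun).comp (polyScale i))
    (algebraMap_polyScale_injective i)

theorem scale_algebraMap (i : Fin 3) (p : MvPolynomial (Fin 3) ℂ) :
    scale i (algebraMap _ RatFun p) = algebraMap _ RatFun (polyScale i p) :=
  IsFractionRing.lift_algebraMap (algebraMap_polyScale_injective i) p

/-- The cubic root of unity as a constant rational function. -/
def root : RatFun := algebraMap ℂ RatFun cubicRoot

theorem root_cube : root ^ 3 = 1 := by
  rw [root, ← map_pow, cubicRoot_pow, map_one]

theorem root_sum : 1 + root + root ^ 2 = 0 := by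
  rw [root, ← map_pow, ← map_one (algebraMap ℂ RatFun), ← map_add, ← map_add, cubicRoot_sum,
    map_zero]

theorem root_ne_zero : root ≠ 0 := fun h => by simpa [h] using root_cube

theorem one_add_root_ne_zero : 1 + root ≠ 0 := fun h => by
  have := root_sum
  rw [h, zero_add] at this
  exact pow_ne_zero 2 root_ne_zero this

theorem root_smul (x : RatFun) : (cubicRoot : ℂ) • x = root * x := Algebra.smul_def _ _

theorem root_inv : root⁻¹ = root ^ 2 :=
  inv_eq_of_mul_eq_one_right (by linear_combination root_cube)

theorem root_inv_smul (x : RatFun) : (cubicRoot : ℂ)⁻¹ • x = root ^ 2 * x := by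
  rw [Algebra.smul_def, map_inv₀, ← root_inv, root]

theorem scale_root (i : Fin 3) : scale i root = root := (scale i).commutes _

theorem scale_coord_self (i : Fin 3) : scale i (coord i) = root * coord i := by
  rw [coord, scale_algebraMap, polyScale, MvPolynomial.aeval_X, if_pos rfl, Algebra.smul_def,
    map_mul, ← IsScalarTower.algebraMap_apply]
  rfl

theorem scale_coord_of_ne {i j : Fin 3} (h : j ≠ i) : scale i (coord j) = coord j := by
  rw [coord, scale_algebraMap, polyScale, MvPolynomial.aeval_X, if_neg h, one_smul]

theorem scale_cube (i : Fin 3) (x : RatFun) : scale i (scale i (scale i x)) = x := by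
  obtain ⟨p, s, _, rfl⟩ := IsFractionRing.div_surjective (MvPolynomial (Fin 3) ℂ) x
  simp only [map_div₀, scale_algebraMap, polyScale_cube]

theorem scale_inv_coord_self (i : Fin 3) :
    scale i (coord i)⁻¹ = root ^ 2 * (coord i)⁻¹ := by
  rw [map_inv₀, scale_coord_self, mul_inv, root_inv]

/-- The operators on rational functions which represent the generators. -/
def repT : Fin 2 → Fin 2 → Module.End ℂ RatFun :=
  ![![LinearMap.mulLeft ℂ (coord 0),
      LinearMap.mulLeft ℂ (coord 1) ∘ₗ (scale 0).toLinearMap ∘ₗ (scale 0).toLinearMap],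
    ![LinearMap.mulLeft ℂ (coord 2) ∘ₗ (scale 0).toLinearMap ∘ₗ (scale 0).toLinearMap,
      LinearMap.mulLeft ℂ (coord 0)⁻¹ ∘ₗ (LinearMap.id +
        LinearMap.mulLeft ℂ (root * (coord 1 * coord 2)) ∘ₗ (scale 0).toLinearMap)]]

theorem repT_a (v : RatFun) : repT 0 0 v = coord 0 * v := rfl
theorem repT_b (v : RatFun) : repT 0 1 v = coord 1 * scale 0 (scale 0 v) := rfl
theorem repT_c (v : RatFun) : repT 1 0 v = coord 2 * scale 0 (scale 0 v) := rfl
theorem repT_d (v : RatFun) : repT 1 1 v =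
    (coord 0)⁻¹ * (v + root * (coord 1 * coord 2) * scale 0 v) := rfl

/-- With `σ` the scaling of `x`, put `a = x`, `b = yσ²`, `c = zσ²`. Since `σ³ = 1`, `bc = yzσ`, and
`d = x⁻¹(1 + q yzσ)` is then forced by `ad = 1 + q bc`. The remaining checks use only `σ x = q x`,
`σ³ = 1` and `q³ = 1`. -/
theorem rels_repT : Rels cubicRoot (repT 0 0) (repT 0 1) (repT 1 0) (repT 1 1) := by
  have hA := coord_ne_zero 0
  have hq := root_cube
  have h1 := scale_coord_of_ne (i := 0) (j := 1) (by decide)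
  have h2 := scale_coord_of_ne (i := 0) (j := 2) (by decide)
  have mul_apply : ∀ (f g : Module.End ℂ RatFun) v, (f * g) v = f (g v) := fun _ _ _ => rfl
  have one_apply : ∀ v, (1 : Module.End ℂ RatFun) v = v := fun _ => rfl
  have smul_apply : ∀ (f : Module.End ℂ RatFun) v,
    ((cubicRoot : ℂ) • f) v = root * f v := fun _ _ => root_smul _
  have smul_apply' : ∀ (f : Module.End ℂ RatFun) v,
    ((cubicRoot : ℂ)⁻¹ • f) v = root ^ 2 * f v := fun _ _ => root_inv_smul _
  constructor <;> refine LinearMap.ext fun v => ?_ <;>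
    simp only [mul_apply, one_apply, smul_apply, smul_apply', LinearMap.add_apply, repT_a, repT_b,
      repT_c, repT_d, map_mul, map_add, map_pow, scale_coord_self, scale_inv_coord_self, h1, h2,
      scale_cube, scale_root] <;>
    field_simp
  · rw [hq, mul_one]
  · rw [hq, mul_one]
  · linear_combination (coord 1 * root *
      (scale 0 (scale 0 v) + coord 1 * root * coord 2 * v)) * hq
  · linear_combination (coord 2 * root *
      (scale 0 (scale 0 v) + coord 2 * root * coord 1 * v)) * hq

/-- The representation of `A(SL_q(2))` on rational functions. -/
def rep : SLq cubicRoot →ₐ[ℂ] Module.End ℂ RatFun := lift repT rels_repT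

theorem rep_T (i j : Fin 2) : rep (T cubicRoot i j) = repT i j := lift_T _ _ i j

theorem rep_mul_apply (x y : SLq cubicRoot) (v : RatFun) : rep (x * y) v = rep x (rep y v) := by
  rw [map_mul]; rfl

theorem rep_cube_apply (x : SLq cubicRoot) (v : RatFun) :
    rep (x ^ 3) v = rep x (rep x (rep x v)) := by
  rw [map_pow]; rfl

/-- The rational functions fixed by all scalings. -/
def invariants : Subalgebra ℂ RatFun := ⨅ i, AlgHom.equalizer (scale i) (AlgHom.id ℂ RatFun)

theorem mem_invariants {f : RatFun} : f ∈ invariants ↔ ∀ i, scale i f = f := by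
  simp [invariants, Algebra.mem_iInf]

theorem coord_cube_mem_invariants (j : Fin 3) : coord j ^ 3 ∈ invariants := by
  refine mem_invariants.2 fun i => ?_
  rw [map_pow]
  by_cases h : j = i
  · rw [h, scale_coord_self, mul_pow, root_cube, one_mul]
  · rw [scale_coord_of_ne h]

theorem rep_a_cube (v : RatFun) : rep (T cubicRoot 0 0 ^ 3) v = coord 0 ^ 3 * v := by
  simp only [rep_cube_apply, rep_T, repT_a]
  ring

theorem rep_b_cube (v : RatFun) : rep (T cubicRoot 0 1 ^ 3) v = coord 1 ^ 3 * v := by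
  simp only [rep_cube_apply, rep_T, repT_b, map_mul, scale_cube,
    scale_coord_of_ne (i := 0) (j := 1) (by decide)]
  ring

theorem rep_c_cube (v : RatFun) : rep (T cubicRoot 1 0 ^ 3) v = coord 2 ^ 3 * v := by
  simp only [rep_cube_apply, rep_T, repT_c, map_mul, scale_cube,
    scale_coord_of_ne (i := 0) (j := 2) (by decide)]
  ring

/-- Read off from `a³d³ - b³c³ = 1`, as the other three cubes act by known functions and `x³` is
invertible. -/
theorem rep_d_cube (v : RatFun) : rep (T cubicRoot 1 1 ^ 3) v =
    (coord 0 ^ 3)⁻¹ * (1 + coord 1 ^ 3 * coord 2 ^ 3) * v := by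
  have h := congrArg (fun x => rep x v) (rels cubicRoot).cube_det
  simp only [map_sub, map_one, LinearMap.sub_apply, rep_mul_apply, rep_a_cube, rep_b_cube,
    rep_c_cube, Module.End.one_apply] at h
  have hA := coord_ne_zero 0
  field_simp
  linear_combination h

theorem exists_invariant {r : SLq cubicRoot} (hr : r ∈ frobenius.range) :
    ∃ f ∈ invariants, ∀ v, rep r v = f * v := by
  have key : frobenius.range ≤ (invariants.map (Algebra.lmul ℂ RatFun)).comap rep := by
    refine frobenius_range_le fun i j => ?_
    have h : ∃ f ∈ invariants, ∀ v, rep (T cubicRoot i j ^ 3) v = f * v := by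
      fin_cases i <;> fin_cases j
      · exact ⟨_, coord_cube_mem_invariants 0, rep_a_cube⟩
      · exact ⟨_, coord_cube_mem_invariants 1, rep_b_cube⟩
      · exact ⟨_, coord_cube_mem_invariants 2, rep_c_cube⟩
      · refine ⟨_, mul_mem ?_ (add_mem (one_mem _) (mul_mem (coord_cube_mem_invariants 1)
          (coord_cube_mem_invariants 2))), rep_d_cube⟩
        exact mem_invariants.2 fun k => by
          rw [map_inv₀, mem_invariants.1 (coord_cube_mem_invariants 0) k]
    obtain ⟨f, hf, h⟩ := h
    exact ⟨f, hf, LinearMap.ext fun v => (h v).symm⟩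
  obtain ⟨f, hf, h⟩ := key hr
  exact ⟨f, hf, fun v => (LinearMap.congr_fun h v).symm⟩

/-! ### Faithfulness on the image of the Frobenius map -/

/-- The images of the cubes of the generators. -/
def cubeFun : Fin 2 × Fin 2 → RatFun := fun ij => rep (T cubicRoot ij.1 ij.2 ^ 3) 1

theorem rep_frobenius_apply (p : MvPolynomial (Fin 2 × Fin 2) ℂ) (v : RatFun) :
    rep (frobenius (Ideal.Quotient.mk detIdeal p)) v = MvPolynomial.aeval cubeFun p * v := by
  have h : (rep.comp frobenius).comp (Ideal.Quotient.mkₐ ℂ detIdeal) =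
      (Algebra.lmul ℂ RatFun).comp (MvPolynomial.aeval cubeFun) := by
    refine MvPolynomial.algHom_ext fun ij => LinearMap.ext fun v => ?_
    obtain ⟨f, -, hf⟩ := exists_invariant (cube_mem_range ij.1 ij.2)
    have e : frobenius (Ideal.Quotient.mk detIdeal (MvPolynomial.X ij)) =
      T cubicRoot ij.1 ij.2 ^ 3 := frobenius_X _ _
    simp only [AlgHom.comp_apply, Ideal.Quotient.mkₐ_eq_mk, e, MvPolynomial.aeval_X, cubeFun, hf,
      mul_one]
    rfl
  exact LinearMap.congr_fun (DFunLike.congr_fun h p) v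

/-- The matrix entries other than the last one. -/
def freeEntry : Fin 3 → Fin 2 × Fin 2 := ![(0, 0), (0, 1), (1, 0)]

theorem cubeFun_freeEntry (i : Fin 3) : cubeFun (freeEntry i) = coord i ^ 3 := by
  fin_cases i
  · exact (rep_a_cube 1).trans (mul_one _)
  · exact (rep_b_cube 1).trans (mul_one _)
  · exact (rep_c_cube 1).trans (mul_one _)

/-- Evaluation at `x³, y³, z³` is the substitution `MvPolynomial.expand 3`, so these cubes are
algebraically independent. -/
theorem aeval_coord_cube_injective :
    Function.Injective (MvPolynomial.aeval (R := ℂ) fun i => coord i ^ 3) := by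
  have h : (MvPolynomial.aeval (R := ℂ) fun i => coord i ^ 3) =
      (IsScalarTower.toAlgHom ℂ (MvPolynomial (Fin 3) ℂ) RatFun).comp (MvPolynomial.expand 3) := by
    refine MvPolynomial.algHom_ext fun i => ?_
    simp [coord]
  rw [h]
  exact (IsFractionRing.injective (MvPolynomial (Fin 3) ℂ) RatFun).comp
    (MvPolynomial.expand_injective (by norm_num))

theorem mk_X_mul_mk_X : Ideal.Quotient.mk detIdeal (MvPolynomial.X (0, 0) * MvPolynomial.X (1, 1)) =
    Ideal.Quotient.mk detIdeal (1 + MvPolynomial.X (0, 1) * MvPolynomial.X (1, 0)) := by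
  refine Ideal.Quotient.eq.2 (Ideal.subset_span ?_)
  simp only [Matrix.det_fin_two, Matrix.mvPolynomialX_apply, Set.mem_singleton_iff]
  ring

/-- Multiplication by a power of `x₀₀` eliminates `x₁₁` from the coordinate ring. -/
theorem exists_pow_mul_eq (p : MvPolynomial (Fin 2 × Fin 2) ℂ) :
    ∃ (n : ℕ) (r : MvPolynomial (Fin 3) ℂ),
      Ideal.Quotient.mk detIdeal (MvPolynomial.X (0, 0) ^ n * p) =
        Ideal.Quotient.mk detIdeal (MvPolynomial.rename freeEntry r) := by
  have hX : ∀ n, MvPolynomial.X (0, 0) ^ n =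
      MvPolynomial.rename (R := ℂ) freeEntry (MvPolynomial.X 0 ^ n) := fun n => by
    simp [freeEntry]
  induction p using MvPolynomial.induction_on with
  | C z => exact ⟨0, MvPolynomial.C z, by simp⟩
  | add p s hp hs =>
    obtain ⟨n, f, hf⟩ := hp
    obtain ⟨m, g, hg⟩ := hs
    refine ⟨n + m, MvPolynomial.X 0 ^ m * f + MvPolynomial.X 0 ^ n * g, ?_⟩
    rw [map_add (MvPolynomial.rename freeEntry), map_mul (MvPolynomial.rename freeEntry),
      map_mul (MvPolynomial.rename freeEntry), ← hX, ← hX, map_add, map_mul _ _ (MvPolynomial.rename freeEntry f), ← hf,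
      map_mul _ _ (MvPolynomial.rename freeEntry g), ← hg, ← map_mul, ← map_mul, ← map_add]
    congr 1
    ring
  | mul_X p ij hp =>
    obtain ⟨n, f, hf⟩ := hp
    have key : ∀ k, ij = freeEntry k → ∃ (n : ℕ) (r : MvPolynomial (Fin 3) ℂ),
        Ideal.Quotient.mk detIdeal (MvPolynomial.X (0, 0) ^ n * (p * MvPolynomial.X ij)) =
          Ideal.Quotient.mk detIdeal (MvPolynomial.rename freeEntry r) := by
      rintro k rfl
      refine ⟨n, f * MvPolynomial.X k, ?_⟩
      rw [map_mul (MvPolynomial.rename freeEntry), MvPolynomial.rename_X,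
        map_mul _ (MvPolynomial.rename freeEntry f), ← hf, ← map_mul, mul_assoc]
    obtain ⟨i, j⟩ := ij
    fin_cases i <;> fin_cases j
    · exact key 0 rfl
    · exact key 1 rfl
    · exact key 2 rfl
    · refine ⟨n + 1, f * (1 + MvPolynomial.X 1 * MvPolynomial.X 2), ?_⟩
      have e : MvPolynomial.rename (R := ℂ) freeEntry
          (1 + MvPolynomial.X 1 * MvPolynomial.X 2) =
            1 + MvPolynomial.X (0, 1) * MvPolynomial.X (1, 0) := by
        simp [freeEntry]
      rw [map_mul (MvPolynomial.rename freeEntry), e,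
        map_mul _ (MvPolynomial.rename freeEntry f), ← hf, ← mk_X_mul_mk_X, ← map_mul]
      congr 1
      simp only [Fin.mk_one]
      ring

/-- The prime `x₀₀` does not divide `det - 1`, whose value at the origin is `-1`; hence powers of
`x₀₀` can be cancelled modulo `det - 1`. -/
theorem mem_detIdeal_of_X_pow_mul_mem {p : MvPolynomial (Fin 2 × Fin 2) ℂ} {n : ℕ}
    (h : MvPolynomial.X (0, 0) ^ n * p ∈ detIdeal) : p ∈ detIdeal := by
  rw [detIdeal, Ideal.mem_span_singleton] at h ⊢
  have hrel : IsRelPrime (MvPolynomial.X (0, 0))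
      ((Matrix.mvPolynomialX (Fin 2) (Fin 2) ℂ).det - 1) := by
    refine (MvPolynomial.X_prime.irreducible.isRelPrime_iff_not_dvd).2 fun hd => ?_
    obtain ⟨s, hs⟩ := hd
    have := congrArg (MvPolynomial.eval 0) hs
    simp [Matrix.det_fin_two] at this
  exact (hrel.symm.pow_right).dvd_of_dvd_mul_left h

/-- After multiplication by a power of `x₀₀` a lift of `r` involves only three entries, which act as
the algebraically independent `x³, y³, z³`; cancelling the power returns to `r`. -/
theorem eq_zero_of_rep_eq_zero {r : SLq cubicRoot} (hr : r ∈ frobenius.range)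
    (h : rep r 1 = 0) : r = 0 := by
  obtain ⟨s, rfl⟩ := hr
  obtain ⟨p, rfl⟩ := Ideal.Quotient.mk_surjective s
  have h0 : MvPolynomial.aeval cubeFun p = 0 := by
    refine Eq.trans ?_ h
    exact (mul_one _).symm.trans (rep_frobenius_apply p 1).symm
  obtain ⟨n, f, hf⟩ := exists_pow_mul_eq p
  have h1 : MvPolynomial.aeval (fun i => coord i ^ 3) f = 0 := by
    have e := (rep_frobenius_apply (MvPolynomial.X (0, 0) ^ n * p) 1).symm.trans
      ((congrArg (fun x => rep (frobenius x) 1) hf).trans (rep_frobenius_apply _ 1))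
    rw [map_mul, h0, mul_zero, zero_mul, mul_one, MvPolynomial.aeval_rename] at e
    have e' : cubeFun ∘ freeEntry = fun i => coord i ^ 3 := funext cubeFun_freeEntry
    rw [e'] at e
    exact e.symm
  have h2 : f = 0 := aeval_coord_cube_injective (h1.trans (map_zero _).symm)
  rw [h2, map_zero, map_zero, Ideal.Quotient.eq_zero_iff_mem] at hf
  have h3 : Ideal.Quotient.mk detIdeal p = 0 :=
    Ideal.Quotient.eq_zero_iff_mem.2 (mem_detIdeal_of_X_pow_mul_mem hf)
  exact (congrArg frobenius h3).trans (map_zero _)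

/-! ### Linear independence -/

/-- Discrete Fourier inversion: combining the sum with its images under `σ` and `σ²`, weighted by
powers of `q`, isolates `3vᵢ`. -/
theorem eq_zero_of_add_eigenvectors {σ : RatFun →ₐ[ℂ] RatFun} {v₀ v₁ v₂ : RatFun}
    (h₀ : σ v₀ = v₀) (h₁ : σ v₁ = root * v₁) (h₂ : σ v₂ = root ^ 2 * v₂)
    (h : v₀ + v₁ + v₂ = 0) : v₀ = 0 ∧ v₁ = 0 ∧ v₂ = 0 := by
  have hr : σ root = root := σ.commutes _
  have e1 : v₀ + root * v₁ + root ^ 2 * v₂ = 0 := by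
    have := congrArg σ h
    simpa only [map_add, map_zero, h₀, h₁, h₂] using this
  have e2 : v₀ + root ^ 2 * v₁ + root * v₂ = 0 := by
    have := congrArg σ e1
    simp only [map_add, map_mul, map_pow, map_zero, h₀, h₁, h₂, hr] at this
    linear_combination this - root * v₂ * root_cube
  have h3 : (3 : RatFun) ≠ 0 := by norm_num
  refine ⟨mul_left_cancel₀ h3 ?_, mul_left_cancel₀ h3 ?_, mul_left_cancel₀ h3 ?_⟩
  · linear_combination h + e1 + e2 - (v₁ + v₂) * root_sum
  · linear_combination h + root ^ 2 * e1 + root * e2 - (v₀ + v₂) * root_sum -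
      (2 * v₁ + root * v₂) * root_cube
  · linear_combination h + root * e1 + root ^ 2 * e2 - (v₀ + v₁) * root_sum -
      (2 * v₂ + root * v₁) * root_cube

theorem eq_zero_of_sum_monomials {h : Fin 3 → Fin 3 → RatFun}
    (h₁ : ∀ j k, scale 1 (h j k) = h j k) (h₂ : ∀ j k, scale 2 (h j k) = h j k)
    (hs : ∑ j : Fin 3, ∑ k : Fin 3, h j k * (coord 1 ^ (j : ℕ) * coord 2 ^ (k : ℕ)) = 0) (j k) :
    h j k = 0 := by
  have hy := coord_ne_zero 1
  have hz := coord_ne_zero 2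
  have h12 := scale_coord_of_ne (i := 1) (j := 2) (by decide)
  have h21 := scale_coord_of_ne (i := 2) (j := 1) (by decide)
  -- Scaling `y` separates the powers of `y`, because each row is fixed by it; scaling `z` then
  -- separates each row.
  have row : ∀ j : Fin 3, ∑ k : Fin 3, h j k * coord 2 ^ (k : ℕ) = 0 := by
    have hs' : ∑ j : Fin 3, coord 1 ^ (j : ℕ) * ∑ k : Fin 3, h j k * coord 2 ^ (k : ℕ) = 0 := by
      rw [← hs]
      refine Finset.sum_congr rfl fun j _ => ?_
      rw [Finset.mul_sum]
      exact Finset.sum_congr rfl fun k _ => by ring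
    have fix : ∀ j : Fin 3, scale 1 (∑ k : Fin 3, h j k * coord 2 ^ (k : ℕ)) =
        ∑ k : Fin 3, h j k * coord 2 ^ (k : ℕ) := fun j => by
      simp only [map_sum, map_mul, map_pow, h₁, h12]
    generalize hR : (fun j : Fin 3 => ∑ k : Fin 3, h j k * coord 2 ^ (k : ℕ)) = R at *
    have hR' : ∀ j : Fin 3, ∑ k : Fin 3, h j k * coord 2 ^ (k : ℕ) = R j := congrFun hR
    simp only [hR'] at hs' fix ⊢
    rw [Fin.sum_univ_three] at hs'
    obtain ⟨a, b, c⟩ := eq_zero_of_add_eigenvectors (σ := scale 1)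
      (by simp [fix]) (by simp [fix, scale_coord_self, mul_assoc])
      (by simp [fix, scale_coord_self, mul_pow, mul_assoc]) hs'
    intro j
    fin_cases j
    · simpa using a
    · simpa [hy] using b
    · simpa [hy] using c
  have hs' := row j
  rw [Fin.sum_univ_three] at hs'
  obtain ⟨a, b, c⟩ := eq_zero_of_add_eigenvectors (σ := scale 2)
    (by simp [h₂]) (by simp [h₂, scale_coord_self, mul_left_comm])
    (by simp [h₂, scale_coord_self, mul_pow, mul_left_comm]) hs'
  fin_cases k
  · simpa using a
  · simpa [hz] using b
  · simpa [hz] using c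

/-- On `1`, monomials in `b` and `c` produce functions fixed by the scaling of `x`, and on such
functions `u` and `v` act by plain multiplication. -/
theorem rep_blockBasis {u v : SLq cubicRoot} {U V : RatFun}
    (hu : ∀ x, scale 0 x = x → rep u x = U * x) (hv : ∀ x, scale 0 x = x → rep v x = V * x)
    (j k : Fin 3) : rep (blockBasis u v j k) 1 =
      (![![U, U * coord 2, U * coord 2 ^ 2], ![U * coord 1, U * (coord 1 * coord 2), V * coord 2],
        ![U * coord 1 ^ 2, V * coord 1, V]] : Fin 3 → Fin 3 → RatFun) j k := by
  have h1 := scale_coord_of_ne (i := 0) (j := 1) (by decide)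
  have h2 := scale_coord_of_ne (i := 0) (j := 2) (by decide)
  fin_cases j <;> fin_cases k <;>
    simp [blockBasis, sq, rep_T, repT_b, repT_c, hu, hv, h1, h2]

theorem rep_monomial (j k : Fin 3) :
    rep (T cubicRoot 0 1 ^ (j : ℕ) * T cubicRoot 1 0 ^ (k : ℕ)) 1 =
      coord 1 ^ (j : ℕ) * coord 2 ^ (k : ℕ) := by
  have h1 := scale_coord_of_ne (i := 0) (j := 1) (by decide)
  have h2 := scale_coord_of_ne (i := 0) (j := 2) (by decide)
  fin_cases j <;> fin_cases k <;>
    simp [sq, rep_T, repT_b, repT_c, h1, h2, mul_assoc]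

theorem rep_a_apply (x : RatFun) : rep (T cubicRoot 0 0) x = coord 0 * x := by
  rw [rep_T, repT_a]

theorem rep_a_sq_apply (x : RatFun) : rep (T cubicRoot 0 0 ^ 2) x = coord 0 ^ 2 * x := by
  rw [sq, rep_mul_apply, rep_T, repT_a, repT_a]
  ring

theorem rep_d_apply (x : RatFun) (hx : scale 0 x = x) : rep (T cubicRoot 1 1) x =
    (coord 0)⁻¹ * (1 + root * (coord 1 * coord 2)) * x := by
  rw [rep_T, repT_d, hx]
  ring

theorem rep_d_sq_apply (x : RatFun) (hx : scale 0 x = x) : rep (T cubicRoot 1 1 ^ 2) x =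
    (coord 0 ^ 2)⁻¹ * (1 + (1 + root) * (coord 1 * coord 2) +
      root * (coord 1 * coord 2) ^ 2) * x := by
  have h1 := scale_coord_of_ne (i := 0) (j := 1) (by decide)
  have h2 := scale_coord_of_ne (i := 0) (j := 2) (by decide)
  have hA := coord_ne_zero 0
  rw [sq, rep_mul_apply, rep_d_apply x hx, rep_T, repT_d]
  simp only [map_mul, map_add, map_one, scale_inv_coord_self, scale_root, h1, h2, hx]
  field_simp
  linear_combination (coord 1 * coord 2 + coord 1 ^ 2 * coord 2 ^ 2 * root) * x * root_cube

theorem block_a_eq_zero {f : Fin 3 → Fin 3 → RatFun} (hf : ∀ j k, f j k ∈ invariants)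
    (hs : ∑ j, ∑ k, f j k *
      rep (blockBasis (T cubicRoot 0 0) (T cubicRoot 1 1 ^ 2) j k) 1 = 0) (j k) : f j k = 0 := by
  have hA := coord_ne_zero 0
  have hr := root_ne_zero
  have hr1 := one_add_root_ne_zero
  simp only [rep_blockBasis (fun x _ => rep_a_apply x) rep_d_sq_apply] at hs
  let A := coord 0
  let y := coord 1
  let z := coord 2
  -- `h j k` is the coefficient of `yʲ zᵏ` after expanding `d² ↦ x⁻²(1 + (1 + q)yz + q y²z²)`; the
  -- factors `y³` and `z³`, being invariant, are folded into the coefficients.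
  let h : Fin 3 → Fin 3 → RatFun :=
    ![![A * f 0 0 + (A ^ 2)⁻¹ * f 2 2, A * f 0 1 + (A ^ 2)⁻¹ * f 1 2,
        A * f 0 2 + (A ^ 2)⁻¹ * root * f 2 1 * y ^ 3],
      ![A * f 1 0 + (A ^ 2)⁻¹ * f 2 1, A * f 1 1 + (A ^ 2)⁻¹ * (1 + root) * f 2 2,
        (A ^ 2)⁻¹ * (1 + root) * f 1 2],
      ![A * f 2 0 + (A ^ 2)⁻¹ * root * f 1 2 * z ^ 3, (A ^ 2)⁻¹ * (1 + root) * f 2 1,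
        (A ^ 2)⁻¹ * root * f 2 2]]
  have hfix : ∀ i : Fin 3, i ≠ 0 → ∀ j k, scale i (h j k) = h j k := by
    intro i hi j k
    have hfi : ∀ j k, scale i (f j k) = f j k := fun j k => mem_invariants.1 (hf j k) i
    have h0 : scale i A = A := scale_coord_of_ne hi.symm
    have h1 : scale i (y ^ 3) = y ^ 3 := mem_invariants.1 (coord_cube_mem_invariants 1) i
    have h2 : scale i (z ^ 3) = z ^ 3 := mem_invariants.1 (coord_cube_mem_invariants 2) i
    rw [map_pow] at h1 h2
    fin_cases j <;> fin_cases k <;>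
      simp [h, hfi, h0, h1, h2, scale_root]
  have H := eq_zero_of_sum_monomials (hfix 1 (by decide)) (hfix 2 (by decide)) (by
    rw [← hs]
    simp only [Fin.sum_univ_three, h, A, y, z]
    simp
    ring)
  -- The system is triangular: the coefficients of `d²c`, `d²b`, `d²` stand alone in entries
  -- `(1,2)`, `(2,1)`, `(2,2)`, and the other six follow.
  have f12 : f 1 2 = 0 := by simpa [h, A, hA, hr1] using H 1 2
  have f21 : f 2 1 = 0 := by simpa [h, A, hA, hr1] using H 2 1
  have f22 : f 2 2 = 0 := by simpa [h, A, hA, hr] using H 2 2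
  have f00 : f 0 0 = 0 := by simpa [h, A, hA, f22] using H 0 0
  have f01 : f 0 1 = 0 := by simpa [h, A, hA, f12] using H 0 1
  have f02 : f 0 2 = 0 := by simpa [h, A, hA, f21] using H 0 2
  have f10 : f 1 0 = 0 := by simpa [h, A, hA, f21] using H 1 0
  have f11 : f 1 1 = 0 := by simpa [h, A, hA, f22] using H 1 1
  have f20 : f 2 0 = 0 := by simpa [h, A, hA, f12] using H 2 0
  fin_cases j <;> fin_cases k <;> assumption

theorem block_d_eq_zero {f : Fin 3 → Fin 3 → RatFun} (hf : ∀ j k, f j k ∈ invariants)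
    (hs : ∑ j, ∑ k, f j k *
      rep (blockBasis (T cubicRoot 1 1) (T cubicRoot 0 0 ^ 2) j k) 1 = 0) (j k) : f j k = 0 := by
  have hA := coord_ne_zero 0
  have hr := root_ne_zero
  simp only [rep_blockBasis rep_d_apply (fun x _ => rep_a_sq_apply x)] at hs
  let A := coord 0
  let y := coord 1
  let z := coord 2
  -- The same expansion, now with the two-term `d ↦ x⁻¹(1 + q yz)` as `u` and `a² ↦ x²` as `v`.
  let h : Fin 3 → Fin 3 → RatFun :=
    ![![A⁻¹ * f 0 0 + A ^ 2 * f 2 2, A⁻¹ * f 0 1 + A⁻¹ * root * f 2 0 * y ^ 3 + A ^ 2 * f 1 2,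
        A⁻¹ * f 0 2],
      ![A⁻¹ * f 1 0 + A⁻¹ * root * f 0 2 * z ^ 3 + A ^ 2 * f 2 1,
        A⁻¹ * (f 1 1 + root * f 0 0), A⁻¹ * root * f 0 1],
      ![A⁻¹ * f 2 0, A⁻¹ * root * f 1 0, A⁻¹ * root * f 1 1]]
  have hfix : ∀ i : Fin 3, i ≠ 0 → ∀ j k, scale i (h j k) = h j k := by
    intro i hi j k
    have hfi : ∀ j k, scale i (f j k) = f j k := fun j k => mem_invariants.1 (hf j k) i
    have h0 : scale i A = A := scale_coord_of_ne hi.symm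
    have h1 : scale i (y ^ 3) = y ^ 3 := mem_invariants.1 (coord_cube_mem_invariants 1) i
    have h2 : scale i (z ^ 3) = z ^ 3 := mem_invariants.1 (coord_cube_mem_invariants 2) i
    rw [map_pow] at h1 h2
    fin_cases j <;> fin_cases k <;>
      simp [h, hfi, h0, h1, h2, scale_root]
  have H := eq_zero_of_sum_monomials (hfix 1 (by decide)) (hfix 2 (by decide)) (by
    rw [← hs]
    simp only [Fin.sum_univ_three, h, A, y, z]
    simp
    ring)
  -- Here the `d`-terms go first, starting from entries with a single unknown; the `a²`-terms come
  -- last.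
  have f02 : f 0 2 = 0 := by simpa [h, A, hA] using H 0 2
  have f20 : f 2 0 = 0 := by simpa [h, A, hA] using H 2 0
  have f01 : f 0 1 = 0 := by simpa [h, A, hA, hr] using H 1 2
  have f10 : f 1 0 = 0 := by simpa [h, A, hA, hr] using H 2 1
  have f11 : f 1 1 = 0 := by simpa [h, A, hA, hr] using H 2 2
  have f00 : f 0 0 = 0 := by simpa [h, A, hA, hr, f11] using H 1 1
  have f22 : f 2 2 = 0 := by simpa [h, A, hA, f00] using H 0 0
  have f12 : f 1 2 = 0 := by simpa [h, A, hA, f01, f20] using H 0 1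
  have f21 : f 2 1 = 0 := by simpa [h, A, hA, f10, f02] using H 1 0
  fin_cases j <;> fin_cases k <;> assumption

theorem scale_rep_blockBasis {u v : SLq cubicRoot} {U V r : RatFun}
    (hu : ∀ x, scale 0 x = x → rep u x = U * x) (hv : ∀ x, scale 0 x = x → rep v x = V * x)
    (hU : scale 0 U = r * U) (hV : scale 0 V = r * V) (j k : Fin 3) :
    scale 0 (rep (blockBasis u v j k) 1) = r * rep (blockBasis u v j k) 1 := by
  have h1 := scale_coord_of_ne (i := 0) (j := 1) (by decide)
  have h2 := scale_coord_of_ne (i := 0) (j := 2) (by decide)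
  rw [rep_blockBasis hu hv]
  fin_cases j <;> fin_cases k <;> simp [h1, h2, hU, hV, mul_assoc]

theorem eq_zero_of_sum_basisVec {f : Fin 3 → Fin 3 → Fin 3 → RatFun}
    (hf : ∀ i j k, f i j k ∈ invariants)
    (hs : ∑ i, ∑ j, ∑ k, f i j k * rep (basisVec i j k) 1 = 0) (i j k) : f i j k = 0 := by
  have h1 := scale_coord_of_ne (i := 0) (j := 1) (by decide)
  have h2 := scale_coord_of_ne (i := 0) (j := 2) (by decide)
  have hf0 : ∀ i j k, scale 0 (f i j k) = f i j k := fun i j k => mem_invariants.1 (hf i j k) 0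
  have E0 : ∀ j k, rep (basisVec 0 j k) 1 = coord 1 ^ (j : ℕ) * coord 2 ^ (k : ℕ) := rep_monomial
  rw [Fin.sum_univ_three] at hs
  -- Scaling `x` gives `a` the eigenvalue `q` and `d²` the eigenvalue `q⁻² = q`; likewise `d` and
  -- `a²` share `q² = q⁻¹`. This separates the three families.
  have S1 : ∀ j k, scale 0 (rep (basisVec 1 j k) 1) = root * rep (basisVec 1 j k) 1 :=
    scale_rep_blockBasis (fun x _ => rep_a_apply x) rep_d_sq_apply (scale_coord_self 0) (by
      have := scale_inv_coord_self 0
      simp only [← inv_pow, map_mul, map_pow, map_add, map_one, this, scale_root, h1, h2]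
      linear_combination ((coord 0)⁻¹ ^ 2 * (1 + (1 + root) * (coord 1 * coord 2) +
        root * (coord 1 * coord 2) ^ 2)) * root * root_cube)
  have S2 : ∀ j k, scale 0 (rep (basisVec 2 j k) 1) = root ^ 2 * rep (basisVec 2 j k) 1 :=
    scale_rep_blockBasis rep_d_apply (fun x _ => rep_a_sq_apply x) (by
      simp only [scale_inv_coord_self, map_mul, map_add, map_one, scale_root, h1, h2]
      ring) (by rw [map_pow, scale_coord_self]; ring)
  obtain ⟨s0, s1, s2⟩ := eq_zero_of_add_eigenvectors (σ := scale 0)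
    (by simp only [map_sum, map_mul, map_pow, hf0, E0, h1, h2])
    (by simp only [map_sum, map_mul, hf0, S1, Finset.mul_sum, mul_left_comm])
    (by simp only [map_sum, map_mul, hf0, S2, Finset.mul_sum, mul_left_comm]) hs
  have c0 := eq_zero_of_sum_monomials (h := f 0) (fun j k => mem_invariants.1 (hf 0 j k) 1)
    (fun j k => mem_invariants.1 (hf 0 j k) 2) (by simpa only [E0] using s0)
  have c1 := block_a_eq_zero (f := f 1) (hf 1) s1
  have c2 := block_d_eq_zero (f := f 2) (hf 2) s2
  fin_cases i
  exacts [c0 j k, c1 j k, c2 j k]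

theorem linearIndependent_basisVec : LinearIndependent frobenius.range
    (fun i : Fin 3 × Fin 3 × Fin 3 => basisVec i.1 i.2.1 i.2.2) := by
  refine Fintype.linearIndependent_iff.2 fun g hg => ?_
  choose f hf hfr using fun i => exists_invariant (g i).2
  have key : ∑ i, ∑ j, ∑ k, f (i, j, k) * rep (basisVec i j k) 1 = 0 := by
    have h := congrArg (fun x => rep x 1) hg
    simp only [range_smul_def, map_sum, LinearMap.sum_apply, rep_mul_apply, hfr, map_zero,
      LinearMap.zero_apply, Fintype.sum_prod_type] at h
    exact h
  rintro ⟨i, j, k⟩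
  have h0 := eq_zero_of_sum_basisVec (f := fun i j k => f (i, j, k)) (fun i j k => hf _) key i j k
  -- So far only the function by which the coefficient acts is known to vanish; faithfulness on `B`
  -- gives the coefficient itself.
  refine Subtype.ext (eq_zero_of_rep_eq_zero (g (i, j, k)).2 ?_)
  rw [hfr]
  exact mul_eq_zero_of_left h0 _

/-- The basis of `A(SL_q(2))` over the image of the Frobenius map. -/
def frobeniusBasis :
    Module.Basis (Fin 3 × Fin 3 × Fin 3) frobenius.range (SLq cubicRoot) :=
  .mk linearIndependent_basisVec span_basisVec.ge

theorem frobeniusBasis_zero : frobeniusBasis (0, 0, 0) = 1 := by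
  simp [frobeniusBasis, basisVec]

instance : Nontrivial (SLq cubicRoot) :=
  (counit cubicRoot).toRingHom.domain_nontrivial

/-- The image of the Frobenius map, being commutative, is isomorphic to its opposite. -/
def rangeEquivOp : frobenius.range ≃+* frobenius.range.op where
  toFun r := ⟨MulOpposite.op (r : SLq cubicRoot), r.2⟩
  invFun r := ⟨MulOpposite.unop (r : (SLq cubicRoot)ᵐᵒᵖ), r.2⟩
  left_inv _ := rfl
  right_inv _ := rfl
  map_add' _ _ := rfl
  map_mul' r s := Subtype.ext (congrArg MulOpposite.op (frobenius_range_comm r.2 s))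

end SLq

end

theorem corollary3p6 :
    SLq.comoduleAlgebra.IsFaithfullyFlatGaloisExtension SLq.frobenius.range := by
  refine ⟨SLq.isGaloisExtension_of_retraction (SLq.frobeniusBasis.coord (0, 0, 0)) ?_, ?_, ?_⟩
  -- The basis vector with index `(0, 0, 0)` is `b⁰c⁰ = 1`, so its coordinate function is a
  -- retraction onto `B`.
  · rw [← SLq.frobeniusBasis_zero, Module.Basis.coord_apply, Module.Basis.repr_self,
      Finsupp.single_eq_same]
  · have := Module.Free.of_basis SLq.frobeniusBasis
    infer_instance
  -- By centrality the left and right actions of `B` coincide, so the same basis works on the right.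
  · have := Module.Free.of_basis (SLq.frobeniusBasis.mapCoeffs SLq.rangeEquivOp
      fun r x => (SLq.frobenius_range_comm r.2 x).symm)
    infer_instance
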